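/- \textbf{Setting.} Algorithms are programs with a step count over finite binary trees (strings), equivalent to Turing machines up to polynomial overhead; probabilistic programs may toss fair coins, and quantum programs may also apply gates from $\{H,T,X,\mathrm{CNOT}\}$ to a quantum memory and measure its qubits. PPT and QPT mean polynomial time in the length of the classical input, for every input and every content of the memory. A non-uniform QPT adversary is given, for each security parameter $\lambda$, a classical string and a quantum state, both of size $\mathrm{poly}(\lambda)$. A function $\mathsf{negl}$ is negligible if $\lambda^k\,\mathsf{negl}(\lambda)\to 0$ for every $k$. \textbf{PKE.} Let $\mathsf{PKE}=(\mathsf{KG},\mathsf{Enc},\mathsf{Dec})$ be a perfectly correct public-key encryption scheme for single-bit messages, with $\mathsf{KG},\mathsf{Enc}$ PPT and $\mathsf{Dec}$ deterministic polynomial time. It is IND-CPA secure if for every non-uniform QPT adversary, which receives $\mathsf{ek}$, chooses $(m_0,m_1)$, receives $\mathsf{Enc}(\mathsf{ek},m_{b})$ and outputs a bit, the probabilities that this bit is $1$ for $b=0$ and for $b=1$ differ by at most a negligible function of $\lambda$. \textbf{Construction.} Let $\ell=\ell(\lambda)$ be bounded by a polynomial. The watermarkable scheme $\mathsf{WPKE}$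 with marks and messages in $\{0,1\}^\ell$ is as follows. \begin{itemize} \item $\mathsf{KG}(1^\lambda)$: generate $(\mathsf{ek}_{j,b},\mathsf{dk}_{j,b})\leftarrow\mathsf{PKE.KG}(1^\lambda)$ independently for $j\in[\ell]$, $b\in\{0,1\}$; output $\mathsf{ek}=\{\mathsf{ek}_{j,b}\}_{j,b}$ and $\mathsf{msk}=\{\mathsf{dk}_{j,b}\}_{j,b}$. \item $\mathsf{Mark}(\mathsf{msk},x)$: output $\mathsf{dk}(x)=(x,\{\mathsf{dk}_{j,x[j]}\}_{j\in[\ell]})$. \item $\mathsf{Enc}(\mathsf{ek},m)$: output $\{\mathsf{ct}_{j,b}\}_{j,b}$ with $\mathsf{ct}_{j,b}\leftarrow\mathsf{PKE.Enc}(\mathsf{ek}_{j,b},m_j)$. \item $\mathsf{Dec}$: with $\mathsf{dk}(x)$, output the bits $\mathsf{PKE.Dec}(\mathsf{dk}_{j,x[j]},\mathsf{ct}_{j,x[j]})$, $j\in[\ell]$; with $\mathsf{msk}$, do the same with $x=0^\ell$. \end{itemize} \textbf{Parallel experiments.} For $n=n(\lambda)$ and a non-uniform QPT adversary $\mathcal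 A$: the challenger generates $(\mathsf{ek}_i,\mathsf{msk}_i)\leftarrow\mathsf{KG}(1^\lambda)$ for $i\in[n]$ and sends $\{\mathsf{ek}_i\}_i$; $\mathcal A$ answers with $x_1,\dots,x_n\in\{0,1\}^\ell$ and receives $\{\mathsf{Mark}(\mathsf{msk}_i,x_i)\}_i$. At this point $\mathcal A$ consists of (the description of) a unitary circuit $U_{\mathcal A}$ and a quantum state $\rho_{\mathcal A}$; it is run on ciphertexts by writing them into an input register, applying $U_{\mathcal A}$ to this register and $\rho_{\mathcal A}$, and measuring an output register. \begin{itemize} \item \emph{One-way inversion:} the challenger draws $m_i\leftarrow\{0,1\}^\ell$ uniformly and $\mathsf{ct}_i\leftarrow\mathsf{Enc}(\mathsf{ek}_i,m_i)$; $\mathcal A$ is run on $\{\mathsf{ct}_i\}_i$ and wins if its output is $(m_1,\dots,m_n)$. The probability of winning is $\mathsf{Adv}^{\mathsf{par\text{-}ow}}_{\mathcal A,n}(\lambda)$. \item \emph{Mark extraction} for an algorithm $\mathcal{E}xt$: instead, run $\mathcal{E}xt(1^\lambda,\{\mathsf{ek}_i\}_i,(U_{\mathcal A},\rho_{\mathcal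 A}))$. The experiment succeeds if the output is $(x_1,\dots,x_n)$; the probability of this is $\mathsf{Adv}^{\mathsf{par\text{-}ext}}_{\mathcal A,\mathcal{E}xt,n}(\lambda)$. \end{itemize} \textbf{Theorem.} If $\mathsf{PKE}$ is IND-CPA secure, then $\mathsf{WPKE}$ is parallel mark extractable: there is a (uniform) QPT algorithm $\mathcal{E}xt$ such that for every polynomially bounded $n=n(\lambda)$ and every non-uniform QPT adversary $\mathcal A$ there is a negligible function $\mathsf{negl}$ with \[ \mathsf{Adv}^{\mathsf{par\text{-}ext}}_{\mathcal A,\mathcal{E}xt,n}(\lambda)\;\ge\;\mathsf{Adv}^{\mathsf{par\text{-}ow}}_{\mathcal A,n}(\lambda)-\mathsf{negl}(\lambda)\qquad\text{for all }\lambda . \] -/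

import Mathlib

noncomputable section

/-! ## Data and polynomially bounded functions -/

/-- Finite binary trees, the strings of the machine model (pairs, lists, unary numbers and bits are
all encoded in them). -/
inductive Data : Type
  | nil : Data
  | cons (a b : Data) : Data
  deriving DecidableEq

namespace Data

/-- Length of the encoding: the number of nodes. -/
def size : Data → ℕ
  | nil => 1
  | cons a b => a.size + b.size + 1

def fst : Data → Data
  | nil => nil
  | cons a _ => a

def snd : Data → Data
  | nil => nil
  | cons _ b => b

/-- Length of a tree read as a list (along the right spine). -/
def len : Data → ℕ
  | nil => 0
  | cons _ b => b.len + 1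

/-- The entry at position `k` of a tree read as a list (`nil` beyond the end). -/
def nth : Data → ℕ → Data
  | x, 0 => x.fst
  | x, k + 1 => x.snd.nth k

def ofBit : Bool → Data
  | false => nil
  | true => cons nil nil

def toBit : Data → Bool
  | nil => false
  | cons _ _ => true

def ofList : List Data → Data
  | [] => nil
  | a :: l => cons a (ofList l)

/-- The entries of a tree read as a list. -/
def toList : Data → List Data
  | nil => []
  | cons a b => a :: b.toList

def ofFn {n : ℕ} (f : Fin n → Data) : Data := ofList (List.ofFn f)

/-- The number `n` in unary; `unary lam` is the string `1^lam`. -/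
def unary (n : ℕ) : Data := ofList (List.replicate n nil)

/-- Prefix-free serialization of a tree as a bit string. -/
def bits : Data → List Bool
  | nil => [false]
  | cons a b => true :: (a.bits ++ b.bits)

end Data

/-- `f(lam) ≤ poly(lam)`. -/
def PolyBounded (f : ℕ → ℕ) : Prop :=
  ∃ p : Polynomial ℕ, ∀ lam, f lam ≤ p.eval lam

/-- Negligible functions of the security parameter. -/
def Negligible (f : ℕ → ℝ) : Prop :=
  Asymptotics.SuperpolynomialDecay Filter.atTop (fun lam : ℕ => (lam : ℝ)) f

/-! ## Quantum memory -/

/-- The qubits: private memory, a register that receives ciphertexts, and an output register. -/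
inductive Wire : Type
  | mem (k : ℕ) : Wire
  | inp (k : ℕ) : Wire
  | out (i j : ℕ) : Wire
  deriving DecidableEq

/-- Vectors on finitely many qubits. The computational basis state with exactly the wires in `s`
equal to `1` is `Finsupp.single s 1`; all the other wires are `0`. -/
abbrev QVec : Type := Finset Wire →₀ ℂ

def QVec.normSq (v : QVec) : ℝ := v.sum fun _ z => ‖z‖ ^ 2

/-- Universal gate set. -/
inductive Gate : Type
  | hadamard (w : Wire) : Gate
  | tgate (w : Wire) : Gate
  | not (w : Wire) : Gate
  | cnot (control target : Wire) : Gate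

/-- Flip the value of the wire `w` in a basis state. -/
def flipWire (w : Wire) (s : Finset Wire) : Finset Wire := symmDiff s {w}

/-- The image of a computational basis state under a gate (a `cnot` whose control and target
coincide does nothing). -/
def Gate.column : Gate → Finset Wire → QVec
  | .hadamard w, s =>
      ((1 / Real.sqrt 2 : ℝ) : ℂ) •
        (Finsupp.single (flipWire w s) 1 + Finsupp.single s (if w ∈ s then -1 else 1))
  | .tgate w, s =>
      Finsupp.single s (if w ∈ s then Complex.exp (Complex.I * Real.pi / 4) else 1)
  | .not w, s => Finsupp.single (flipWire w s) 1
  | .cnot c t, s => Finsupp.single (if c ∈ s ∧ c ≠ t then flipWire t s else s) 1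

/-- Linear extension of `Gate.column`. -/
def Gate.toLin (g : Gate) : QVec →ₗ[ℂ] QVec := Finsupp.linearCombination ℂ g.column

theorem flipWire_flipWire (w : Wire) (s : Finset Wire) : flipWire w (flipWire w s) = s := by
  simp [flipWire]

theorem mem_flipWire_self (w : Wire) (s : Finset Wire) : w ∈ flipWire w s ↔ w ∉ s := by
  simp [flipWire, Finset.mem_symmDiff]

theorem mem_flipWire_of_ne {c t : Wire} (h : c ≠ t) (s : Finset Wire) :
    c ∈ flipWire t s ↔ c ∈ s := by
  simp [flipWire, Finset.mem_symmDiff, h]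

theorem QVec.normSq_eq_tsum (v : QVec) : v.normSq = ∑' s, ‖v s‖ ^ 2 := by
  rw [QVec.normSq, Finsupp.sum, tsum_eq_sum]
  intro s hs
  simp [Finsupp.notMem_support_iff.mp hs]

theorem QVec.summable (v : QVec) : Summable fun s => ‖v s‖ ^ 2 :=
  summable_of_ne_finset_zero (s := v.support) fun s hs => by
    simp [Finsupp.notMem_support_iff.mp hs]

theorem QVec.normSq_nonneg (v : QVec) : 0 ≤ v.normSq :=
  Finset.sum_nonneg fun _ _ => by positivity

theorem QVec.normSq_smul (c : ℂ) (v : QVec) : (c • v).normSq = ‖c‖ ^ 2 * v.normSq := by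
  simp [QVec.normSq_eq_tsum, mul_pow, tsum_mul_left]

theorem Gate.toLin_hadamard_apply (w : Wire) (v : QVec) (t : Finset Wire) :
    (Gate.hadamard w).toLin v t =
      ((1 / Real.sqrt 2 : ℝ) : ℂ) * (v (flipWire w t) + (if w ∈ t then -1 else 1) * v t) := by
  induction v using Finsupp.induction_linear with
  | zero => simp
  | add f g hf hg => rw [map_add, Finsupp.add_apply, hf, hg]; simp only [Finsupp.add_apply]; ring
  | single s z =>
    have h : flipWire w s = t ↔ s = flipWire w t :=
      ⟨fun h => by rw [← h, flipWire_flipWire], fun h => by rw [h, flipWire_flipWire]⟩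
    simp only [Gate.toLin, Finsupp.linearCombination_single, Gate.column, Finsupp.smul_apply,
      Finsupp.add_apply, Finsupp.single_apply, smul_eq_mul, h]
    by_cases h1 : s = t
    · subst h1; split_ifs <;> ring
    · simp only [h1, if_false]; split_ifs <;> ring

theorem Gate.toLin_tgate_apply (w : Wire) (v : QVec) (t : Finset Wire) :
    (Gate.tgate w).toLin v t =
      (if w ∈ t then Complex.exp (Complex.I * Real.pi / 4) else 1) * v t := by
  induction v using Finsupp.induction_linear with
  | zero => simp
  | add f g hf hg => rw [map_add, Finsupp.add_apply, hf, hg]; simp only [Finsupp.add_apply]; ring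
  | single s z =>
    simp only [Gate.toLin, Finsupp.linearCombination_single, Gate.column, Finsupp.smul_apply,
      Finsupp.single_apply, smul_eq_mul]
    by_cases h1 : s = t
    · subst h1; simp only [if_true]; ring
    · simp [h1]

theorem Gate.toLin_not_apply (w : Wire) (v : QVec) (t : Finset Wire) :
    (Gate.not w).toLin v t = v (flipWire w t) := by
  induction v using Finsupp.induction_linear with
  | zero => simp
  | add f g hf hg => rw [map_add, Finsupp.add_apply, hf, hg]; simp only [Finsupp.add_apply]
  | single s z =>
    have h : flipWire w s = t ↔ s = flipWire w t :=
      ⟨fun h => by rw [← h, flipWire_flipWire], fun h => by rw [h, flipWire_flipWire]⟩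
    simp [Gate.toLin, Gate.column, Finsupp.single_apply, h]

/-- The permutation of the basis states performed by a `cnot`. -/
def cnotPerm (c t : Wire) (s : Finset Wire) : Finset Wire :=
  if c ∈ s ∧ c ≠ t then flipWire t s else s

theorem cnotPerm_cnotPerm (c t : Wire) (s : Finset Wire) :
    cnotPerm c t (cnotPerm c t s) = s := by
  by_cases h : c ∈ s ∧ c ≠ t
  · have h' : c ∈ flipWire t s ∧ c ≠ t := ⟨(mem_flipWire_of_ne h.2 s).mpr h.1, h.2⟩
    rw [show cnotPerm c t s = flipWire t s from if_pos h,
      show cnotPerm c t (flipWire t s) = flipWire t (flipWire t s) from if_pos h',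
      flipWire_flipWire]
  · rw [show cnotPerm c t s = s from if_neg h, show cnotPerm c t s = s from if_neg h]

theorem Gate.toLin_cnot_apply (c d : Wire) (v : QVec) (t : Finset Wire) :
    (Gate.cnot c d).toLin v t = v (cnotPerm c d t) := by
  induction v using Finsupp.induction_linear with
  | zero => simp
  | add f g hf hg => rw [map_add, Finsupp.add_apply, hf, hg]; simp only [Finsupp.add_apply]
  | single s z =>
    have h : cnotPerm c d s = t ↔ s = cnotPerm c d t :=
      ⟨fun h => by rw [← h, cnotPerm_cnotPerm], fun h => by rw [h, cnotPerm_cnotPerm]⟩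
    have hc : Gate.column (.cnot c d) s = Finsupp.single (cnotPerm c d s) 1 := rfl
    simp [Gate.toLin, hc, Finsupp.single_apply, h]

theorem tsum_comp_involutive (f : Finset Wire → Finset Wire) (hf : ∀ s, f (f s) = s)
    (g : Finset Wire → ℝ) : ∑' s, g (f s) = ∑' s, g s :=
  (⟨f, f, hf, hf⟩ : Equiv.Perm (Finset Wire)).tsum_eq g

/-- Gates are isometries. -/
theorem Gate.normSq_toLin (g : Gate) (v : QVec) : (g.toLin v).normSq = v.normSq := by
  rw [QVec.normSq_eq_tsum, QVec.normSq_eq_tsum]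
  cases g with
  | hadamard w =>
    have e : ∀ u : QVec, ∑' s, (‖u s‖ ^ 2 + ‖u (flipWire w s)‖ ^ 2) = 2 * ∑' s, ‖u s‖ ^ 2 := by
      intro u
      have hs : Summable fun s => ‖u (flipWire w s)‖ ^ 2 :=
        (⟨flipWire w, flipWire w, flipWire_flipWire w, flipWire_flipWire w⟩ :
          Equiv.Perm (Finset Wire)).summable_iff.mpr u.summable
      rw [u.summable.tsum_add hs, tsum_comp_involutive _ (flipWire_flipWire w) fun s => ‖u s‖ ^ 2]
      ring
    have key : ∀ a b : ℂ, ‖((1 / Real.sqrt 2 : ℝ) : ℂ) * (b + a)‖ ^ 2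
        + ‖((1 / Real.sqrt 2 : ℝ) : ℂ) * (a - b)‖ ^ 2 = ‖a‖ ^ 2 + ‖b‖ ^ 2 := by
      intro a b
      have h2 : ‖((1 / Real.sqrt 2 : ℝ) : ℂ)‖ ^ 2 = 1 / 2 := by
        rw [Complex.norm_real, Real.norm_eq_abs, sq_abs, div_pow, Real.sq_sqrt (by norm_num)]
        norm_num
      rw [norm_mul, norm_mul, mul_pow, mul_pow, h2]
      have := parallelogram_law_with_norm ℝ a b
      rw [add_comm b a]
      nlinarith [this]
    have h1 := e ((Gate.hadamard w).toLin v)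
    have h2 : ∑' s, (‖(Gate.hadamard w).toLin v s‖ ^ 2
        + ‖(Gate.hadamard w).toLin v (flipWire w s)‖ ^ 2)
        = ∑' s, (‖v s‖ ^ 2 + ‖v (flipWire w s)‖ ^ 2) := by
      refine tsum_congr fun s => ?_
      rw [Gate.toLin_hadamard_apply, Gate.toLin_hadamard_apply, flipWire_flipWire]
      have hm := mem_flipWire_self w s
      by_cases h : w ∈ s
      · have h' : w ∉ flipWire w s := fun hh => (hm.mp hh) h
        rw [if_pos h, if_neg h', add_comm (‖v s‖ ^ 2), ← key (v (flipWire w s)) (v s), add_comm]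
        congr 3 <;> ring
      · have h' : w ∈ flipWire w s := hm.mpr h
        rw [if_neg h, if_pos h', ← key (v s) (v (flipWire w s))]
        congr 3 <;> ring
    rw [h2, e v] at h1
    linarith
  | tgate w =>
    refine tsum_congr fun s => ?_
    rw [Gate.toLin_tgate_apply]
    split_ifs
    · rw [norm_mul, Complex.norm_exp]
      simp
    · simp
  | not w =>
    simp only [Gate.toLin_not_apply]
    exact tsum_comp_involutive _ (flipWire_flipWire w) fun s => ‖v s‖ ^ 2
  | cnot c t =>
    simp only [Gate.toLin_cnot_apply]
    exact tsum_comp_involutive _ (cnotPerm_cnotPerm c t) fun s => ‖v s‖ ^ 2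

/-- Pure states of finitely many qubits. -/
structure QState : Type where
  amp : QVec
  norm_one : amp.normSq = 1

namespace QState

/-- All qubits are `0`. -/
def zero : QState := ⟨Finsupp.single ∅ 1, by simp [QVec.normSq]⟩

def applyGate (g : Gate) (ψ : QState) : QState :=
  ⟨g.toLin ψ.amp, by rw [Gate.normSq_toLin, ψ.norm_one]⟩

/-- Apply the gates of a unitary circuit from left to right. -/
def applyCircuit (U : List Gate) (ψ : QState) : QState := U.foldl (fun φ g => applyGate g φ) ψ

/-- Born's rule: the distribution of a measurement of all qubits in the computational basis. -/
def born (ψ : QState) : PMF (Finset Wire) :=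
  ⟨fun s => ENNReal.ofReal (‖ψ.amp s‖ ^ 2), by
    have h : HasSum (fun s => ‖ψ.amp s‖ ^ 2) 1 := by
      have := ψ.amp.summable.hasSum
      rwa [← QVec.normSq_eq_tsum, ψ.norm_one] at this
    have h' := ENNReal.summable (f := fun s => ENNReal.ofReal (‖ψ.amp s‖ ^ 2)) |>.hasSum
    rwa [← ENNReal.ofReal_tsum_of_nonneg (fun _ => by positivity) h.summable, h.tsum_eq,
      ENNReal.ofReal_one] at h'⟩

open Classical in
/-- The normalized state after the qubits in `W` have been measured, exactly those in `o` with the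
outcome `1` (unchanged if this outcome has probability `0`). -/
def collapse (W o : Finset Wire) (ψ : QState) : QState :=
  let v : QVec := ψ.amp.filter fun s => s ∩ W = o
  if h : v.normSq = 0 then ψ
  else ⟨(((Real.sqrt v.normSq)⁻¹ : ℝ) : ℂ) • v, by
    rw [QVec.normSq_smul, Complex.norm_real, Real.norm_eq_abs, sq_abs, inv_pow,
      Real.sq_sqrt v.normSq_nonneg, inv_mul_cancel₀ h]⟩

/-- Measure the qubits in `W` in the computational basis. The outcome is the set of those qubits
that gave `1`. -/
def measure (W : Finset Wire) (ψ : QState) : PMF (Finset Wire × QState) :=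
  ψ.born.bind fun s => PMF.pure (s ∩ W, ψ.collapse W (s ∩ W))

/-- Write a bit string into the ciphertext register, one bit per qubit: a NOT on each qubit whose
bit is `1`. -/
def load (l : List Bool) (ψ : QState) : QState :=
  l.zipIdx.foldl (fun φ p => if p.1 then applyGate (.not (.inp p.2)) φ else φ) ψ

end QState

/-! ## Machine model -/

/-- Wires, gates and circuits are described by trees; wire indices are in unary. -/
def Data.toWire (x : Data) : Wire :=
  match x.fst.len with
  | 0 => .mem x.snd.len
  | 1 => .inp x.snd.len
  | _ => .out x.snd.fst.len x.snd.snd.len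

def Data.toGate (x : Data) : Gate :=
  match x.fst.len with
  | 0 => .hadamard x.snd.toWire
  | 1 => .tgate x.snd.toWire
  | 2 => .not x.snd.toWire
  | _ => .cnot x.snd.fst.toWire x.snd.snd.toWire

def Data.toCircuit (x : Data) : List Gate := x.toList.map Data.toGate

/-- A machine configuration: quantum memory and elapsed time. -/
structure Machine : Type where
  mem : QState
  time : ℕ

/-- Randomized computations that act on the machine configuration. -/
abbrev Comp (α : Type) : Type := Machine → PMF (α × Machine)

def Comp.ret {α : Type} (a : α) : Comp α := fun M => PMF.pure (a, M)

def Comp.andThen {α β : Type} (c : Comp α) (f : α → Comp β) : Comp β := fun M =>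
  (c M).bind fun r => f r.1 r.2

/-- Programs: a classical language on trees, with coin tosses and instructions that act on the
quantum memory. Each loop runs over a list, so every program halts; with loops nested to a fixed
depth, and with `bits` to traverse trees, exactly the polynomial-time functions are computed by the
programs whose cost (below) is polynomial. -/
inductive Code : Type
  | id : Code
  | nil : Code
  | fst : Code
  | snd : Code
  | bits : Code
  | pair (f g : Code) : Code
  | comp (f g : Code) : Code
  | ite (c f g : Code) : Code
  | fold (f : Code) : Code
  | coin : Code
  | gate : Code
  | meas : Code

namespace Code

/-- Let time `n` pass. -/
def tick (n : ℕ) : Comp Unit := fun M => PMF.pure ((), ⟨M.mem, M.time + n⟩)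

/-- Loop over the entries of a list, with an accumulator. -/
def foldLoop (step : Data → Data → Comp Data) : Data → Data → Comp Data
  | .nil, s => .ret s
  | .cons a l, s => (step a s).andThen (foldLoop step l)

/-- Toss a fair coin. -/
def tossCoin : Comp Data := fun M =>
  (PMF.uniformOfFintype Bool).bind fun b => PMF.pure (Data.ofBit b, M)

/-- Apply the described gate to the quantum memory. -/
def gateStep (x : Data) : Comp Data := fun M =>
  PMF.pure (Data.nil, ⟨M.mem.applyGate x.toGate, M.time⟩)

/-- Measure the listed wires and return the list of outcomes. -/
def measStep (x : Data) : Comp Data := fun M =>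
  (M.mem.measure (x.toList.map Data.toWire).toFinset).bind fun r =>
    PMF.pure
      (Data.ofList (x.toList.map fun w => Data.ofBit (decide (w.toWire ∈ r.1))), ⟨r.2, M.time⟩)

/-- Execution of a program on an input. Every executed instruction costs one plus the size of the
tree that it works on. -/
def run : Code → Data → Comp Data
  | .id, x => (tick (x.size + 1)).andThen fun _ => .ret x
  | .nil, x => (tick (x.size + 1)).andThen fun _ => .ret Data.nil
  | .fst, x => (tick (x.size + 1)).andThen fun _ => .ret x.fst
  | .snd, x => (tick (x.size + 1)).andThen fun _ => .ret x.snd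
  | .bits, x => (tick (x.size + 1)).andThen fun _ => .ret (Data.ofList (x.bits.map Data.ofBit))
  | .pair f g, x => (tick (x.size + 1)).andThen fun _ =>
      (run f x).andThen fun a => (run g x).andThen fun b => .ret (Data.cons a b)
  | .comp f g, x => (tick (x.size + 1)).andThen fun _ => (run g x).andThen fun y => run f y
  | .ite c f g, x => (tick (x.size + 1)).andThen fun _ =>
      (run c x).andThen fun b => if b.toBit then run f x else run g x
  | .fold f, x => (tick (x.size + 1)).andThen fun _ =>
      foldLoop (fun a s => run f (Data.cons a s)) x.fst x.snd
  | .coin, x => (tick (x.size + 1)).andThen fun _ => tossCoin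
  | .gate, x => (tick (x.size + 1)).andThen fun _ => gateStep x
  | .meas, x => (tick (x.size + 1)).andThen fun _ => measStep x

/-- The joint distribution of the output and of the final quantum memory. -/
def exec (c : Code) (x : Data) (ψ : QState) : PMF (Data × QState) :=
  (c.run x ⟨ψ, 0⟩).bind fun r => PMF.pure (r.1, r.2.mem)

/-- The output distribution of a classical program. -/
def sample (c : Code) (x : Data) : PMF Data :=
  (c.exec x QState.zero).bind fun r => PMF.pure r.1

/-- Polynomial time, in the worst case over random choices and quantum memory contents. A program
with this property is a (uniform) QPT algorithm. -/
def PolyTime (c : Code) : Prop :=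
  ∃ p : Polynomial ℕ, ∀ (x : Data) (ψ : QState),
    ∀ r ∈ (c.run x ⟨ψ, 0⟩).support, r.2.time ≤ p.eval x.size

/-- No quantum instructions. -/
def Classical : Code → Prop
  | .pair f g => f.Classical ∧ g.Classical
  | .comp f g => f.Classical ∧ g.Classical
  | .ite c f g => c.Classical ∧ f.Classical ∧ g.Classical
  | .fold f => f.Classical
  | .gate => False
  | .meas => False
  | _ => True

/-- No coin tosses and no quantum instructions. -/
def Deterministic : Code → Prop
  | .pair f g => f.Deterministic ∧ g.Deterministic
  | .comp f g => f.Deterministic ∧ g.Deterministic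
  | .ite c f g => c.Deterministic ∧ f.Deterministic ∧ g.Deterministic
  | .fold f => f.Deterministic
  | .coin => False
  | .gate => False
  | .meas => False
  | _ => True

/-- Probabilistic polynomial time. -/
def PPT (c : Code) : Prop := c.Classical ∧ c.PolyTime

/-- Deterministic polynomial time. -/
def DPT (c : Code) : Prop := c.Deterministic ∧ c.PolyTime

end Code

/-- Non-uniform advice: for every security parameter a classical string and a pure quantum state,
both of polynomial size. (Mixed states are covered by purification.) -/
structure Advice : Type where
  classical : ℕ → Data
  quantum : ℕ → QState
  bounded : ∃ p : Polynomial ℕ, ∀ lam, (classical lam).size ≤ p.eval lam ∧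
    ∀ s ∈ (quantum lam).amp.support, ∀ w ∈ s, ∃ k < p.eval lam, w = Wire.mem k

/-! ## Public-key encryption of single bits -/

/-- `kg` maps `1^lam` to `(ek, dk)`, `enc` maps `(ek, m)` to a ciphertext, and `dec` maps
`(dk, ct)` to a message. -/
structure PKE : Type where
  kg : Code
  enc : Code
  dec : Code
  kg_ppt : kg.PPT
  enc_ppt : enc.PPT
  dec_dpt : dec.DPT
  correct : ∀ (lam : ℕ) (m : Bool),
    ((kg.sample (Data.unary lam)).bind fun k =>
      (enc.sample (Data.cons k.fst (Data.ofBit m))).bind fun ct =>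
        dec.sample (Data.cons k.snd ct)) (Data.ofBit m) = 1

namespace PKE

def keyGen (P : PKE) (lam : ℕ) : PMF (Data × Data) :=
  (P.kg.sample (Data.unary lam)).bind fun k => PMF.pure (k.fst, k.snd)

def encrypt (P : PKE) (ek : Data) (m : Bool) : PMF Data :=
  P.enc.sample (Data.cons ek (Data.ofBit m))

def decrypt (P : PKE) (dk ct : Data) : PMF Bool :=
  (P.dec.sample (Data.cons dk ct)).bind fun m => PMF.pure m.toBit

end PKE

/-- A non-uniform QPT adversary in the IND-CPA experiment. -/
structure CPAAdversary : Type where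
  advice : Advice
  /-- Maps `(1^lam, advice, ek)` to `((m0, m1), st)`. -/
  choose : Code
  /-- Maps `(st, ct)` to the guess. -/
  guess : Code
  choose_poly : choose.PolyTime
  guess_poly : guess.PolyTime

/-- The IND-CPA experiment; the quantum memory is passed on between the two stages. -/
def expCPA (P : PKE) (A : CPAAdversary) (lam : ℕ) (coin : Bool) : PMF Bool :=
  (P.keyGen lam).bind fun k =>
  (A.choose.exec (Data.cons (Data.unary lam) (Data.cons (A.advice.classical lam) k.1))
    (A.advice.quantum lam)).bind fun r =>
  (P.encrypt k.1 (if coin then r.1.fst.snd.toBit else r.1.fst.fst.toBit)).bind fun ct =>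
  (A.guess.exec (Data.cons r.1.snd ct) r.2).bind fun g =>
  PMF.pure g.1.toBit

def advCPA (P : PKE) (A : CPAAdversary) (lam : ℕ) : ℝ :=
  |(expCPA P A lam false true).toReal - (expCPA P A lam true true).toReal|

def PKE.INDCPA (P : PKE) : Prop := ∀ A : CPAAdversary, Negligible (advCPA P A)

/-! ## Watermarkable public-key encryption -/

/-- The algorithms of a watermarkable PKE, given by their output distributions, with marks in `{0,1}^(markLen lam)` and messages in
`{0,1}^(msgLen lam)`. The first argument, besides the security parameter, of `dec` is a marked key (`Sum.inl`) or a master secret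
key (`Sum.inr`). -/
structure WPKE : Type where
  markLen : ℕ → ℕ
  msgLen : ℕ → ℕ
  kg : ℕ → PMF (Data × Data)
  mark : (lam : ℕ) → Data → (Fin (markLen lam) → Bool) → Data
  enc : (lam : ℕ) → Data → (Fin (msgLen lam) → Bool) → PMF Data
  dec : (lam : ℕ) → Data ⊕ Data → Data → PMF (Fin (msgLen lam) → Bool)

/-- Independent samples. -/
def indep {α : Type} : (n : ℕ) → (Fin n → PMF α) → PMF (Fin n → α)
  | 0, _ => PMF.pure Fin.elim0
  | n + 1, f =>
    (f 0).bind fun a => (indep n fun i => f i.succ).bind fun r => PMF.pure (Fin.cons a r)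

/-- A non-uniform QPT adversary in the parallel experiments. -/
structure ParAdversary : Type where
  advice : Advice
  /-- Maps `(1^lam, advice, [ek_1, ..., ek_n])` to `([x_1, ..., x_n], st)`. -/
  choose : Code
  /-- Maps `(st, [dk_1(x_1), ..., dk_n(x_n)])` to the description of a unitary circuit. -/
  prepare : Code
  choose_poly : choose.PolyTime
  prepare_poly : prepare.PolyTime

/-- What there is before the challenge ciphertexts are generated: the public keys, the marks chosen
by the adversary, its unitary circuit and its quantum state. -/
structure ParView (W : WPKE) (n lam : ℕ) : Type where
  ek : Fin n → Data
  x : Fin n → Fin (W.markLen lam) → Bool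
  circuit : Data
  state : QState

/-- The common first steps of the two parallel experiments. -/
def parSetup (W : WPKE) (A : ParAdversary) (n lam : ℕ) : PMF (ParView W n lam) :=
  (indep n fun _ => W.kg lam).bind fun k =>
  (A.choose.exec
    (Data.cons (Data.unary lam)
      (Data.cons (A.advice.classical lam) (Data.ofFn fun i => (k i).1)))
    (A.advice.quantum lam)).bind fun r =>
  let x : Fin n → Fin (W.markLen lam) → Bool := fun i j => ((r.1.fst.nth i).nth j).toBit
  (A.prepare.exec
    (Data.cons r.1.snd (Data.ofFn fun i => W.mark lam (k i).2 (x i))) r.2).bind fun u =>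
  PMF.pure ⟨fun i => (k i).1, x, u.1, u.2⟩

/-- The qubits that hold `n` messages of `l` bits. -/
def outWires (n l : ℕ) : Finset Wire :=
  (Finset.univ : Finset (Fin n × Fin l)).image fun p => Wire.out p.1 p.2

/-- Run the second part of the adversary: apply its circuit to the ciphertexts and its state, and
measure the output register. -/
def runCircuit {n : ℕ} (l : ℕ) (circuit : Data) (ψ : QState) (ct : Fin n → Data) :
    PMF (Fin n → Fin l → Bool) :=
  (((ψ.load (Data.ofFn ct).bits).applyCircuit circuit.toCircuit).measure (outWires n l)).bind
    fun r => PMF.pure fun i j => decide (Wire.out i j ∈ r.1)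

/-- Parallel one-way inversion experiment. -/
def expParOW (W : WPKE) (A : ParAdversary) (n lam : ℕ) : PMF Bool :=
  (parSetup W A n lam).bind fun v =>
  (indep n fun _ => PMF.uniformOfFintype (Fin (W.msgLen lam) → Bool)).bind fun m =>
  (indep n fun i => W.enc lam (v.ek i) (m i)).bind fun ct =>
  (runCircuit (W.msgLen lam) v.circuit v.state ct).bind fun m' =>
  PMF.pure (decide (m' = m))

/-- Parallel mark extraction experiment. The extractor is run on `1^lam`, the public keys and the
adversary's circuit and state, and outputs a list of marks. -/
def expParExt (W : WPKE) (A : ParAdversary) (Ext : Code) (n lam : ℕ) : PMF Bool :=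
  (parSetup W A n lam).bind fun v =>
  (Ext.exec (Data.cons (Data.unary lam) (Data.cons (Data.ofFn v.ek) v.circuit)) v.state).bind
    fun r =>
  let x' : Fin n → Fin (W.markLen lam) → Bool := fun i j => ((r.1.nth i).nth j).toBit
  PMF.pure (decide (x' = v.x))

def advParOW (W : WPKE) (A : ParAdversary) (n : ℕ → ℕ) (lam : ℕ) : ℝ :=
  (expParOW W A (n lam) lam true).toReal

def advParExt (W : WPKE) (A : ParAdversary) (Ext : Code) (n : ℕ → ℕ) (lam : ℕ) : ℝ :=
  (expParExt W A Ext (n lam) lam true).toReal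

def WPKE.ParallelMarkExtractable (W : WPKE) : Prop :=
  ∃ Ext : Code, Ext.PolyTime ∧
    ∀ n : ℕ → ℕ, PolyBounded n → ∀ A : ParAdversary,
      ∃ ε : ℕ → ℝ, Negligible ε ∧
        ∀ lam, advParOW W A n lam - ε lam ≤ advParExt W A Ext n lam

/-! ## The construction -/

/-- The component `b` of a pair. -/
def Data.sel (x : Data) (b : Bool) : Data := if b then x.snd else x.fst

/-- The watermarkable PKE with marks and messages of `ℓ lam` bits that is built from a PKE for
single bits. The keys and ciphertexts are lists of the pairs of their components for `b = 0, 1`. -/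
def wpkeOf (P : PKE) (ℓ : ℕ → ℕ) : WPKE where
  markLen := ℓ
  msgLen := ℓ
  kg lam :=
    (indep (ℓ lam) fun _ =>
      (P.keyGen lam).bind fun k0 => (P.keyGen lam).bind fun k1 => PMF.pure (k0, k1)).bind fun k =>
    PMF.pure (Data.ofFn fun j => Data.cons (k j).1.1 (k j).2.1,
      Data.ofFn fun j => Data.cons (k j).1.2 (k j).2.2)
  mark _ msk x :=
    Data.cons (Data.ofFn fun j => Data.ofBit (x j)) (Data.ofFn fun j => (msk.nth j).sel (x j))
  enc lam ek m :=
    (indep (ℓ lam) fun j =>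
      (P.encrypt ((ek.nth j).sel false) (m j)).bind fun c0 =>
      (P.encrypt ((ek.nth j).sel true) (m j)).bind fun c1 =>
      PMF.pure (Data.cons c0 c1)).bind fun c =>
    PMF.pure (Data.ofFn c)
  dec _ key ct :=
    match key with
    | .inl dkx => indep _ fun j =>
        P.decrypt (dkx.snd.nth j) ((ct.nth j).sel (dkx.fst.nth j).toBit)
    | .inr msk => indep _ fun j => P.decrypt ((msk.nth j).sel false) ((ct.nth j).sel false)

end

/-! The extractor makes the two components of a ciphertext disagree on purpose. It draws uniform
bits $m_{i,j}$, encrypts $m_{i,j}\oplus b$ under $\mathsf{ek}_{i,j,b}$, runs the adversary once and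
adds $m$ to the answer. A key marked with $x$ opens the component $x_{i,j}$, which holds
$m_{i,j}\oplus x_{i,j}$, so correct decryption betrays the mark. Since $x$ is fixed before $m$ is
drawn, $m$ may be replaced by $m\oplus x$. Extraction then succeeds exactly when the adversary
outputs $m$ on ciphertexts whose component $x_{i,j}$ encrypts $m_{i,j}$ and whose other component
encrypts the opposite bit (`expParExt_eq_hybrid`). One-way inversion is the same experiment with
$m_{i,j}$ in both components (`expParOW_eq_hybrid`).

These are the two ends of a chain of hybrids indexed by the set $S$ of switched positions $(i,j,b)$,
where a switch has an effect only if $b\ne x_{i,j}$. One step of the chain is an IND-CPA game for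
the key at one position $p$. The obstacle is that $p$ has to be fixed before the adversary chooses
$x$: if $b=x_{i,j}$ at $p$, the adversary is owed a secret key that the reduction lacks. The
reduction then hands out a dummy. In this case the two challenge messages coincide, so the spoiled
run contributes equally to both values of the challenge bit, and the two true hybrids agree as well;
if $b\ne x_{i,j}$, the missing key is never handed out. Hence the IND-CPA advantage equals the gap
between the hybrids, without any loss from guessing (`hybridWith_erasePos_add`, `advCPA_reduction`).

For every $\lambda$ the advice of the reduction contains a pair $(S,p)$ with the largest gap. So a
single adversary bounds all gaps, and the total loss is at most the number $2n\ell$ of positions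
times its advantage.

The rest carries this out in the machine model: a semantics without clock (`exec_eq_den`), closure
properties of polynomial time, loops over lists of lists, and the fact that reading the output
register wire by wire gives the same distribution as measuring it at once (`exec_attack`). -/

/-! ### Sizes and entries of trees -/

namespace Data

theorem one_le_size (x : Data) : 1 ≤ x.size := by
  cases x <;> simp [size]

theorem size_fst_le (x : Data) : x.fst.size ≤ x.size := by
  cases x <;> simp [size, fst]; omega

theorem size_snd_le (x : Data) : x.snd.size ≤ x.size := by
  cases x <;> simp [size, snd]; omega

theorem size_le_fst_add_snd (x : Data) : x.size ≤ x.fst.size + x.snd.size + 1 := by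
  cases x <;> simp [size, fst, snd]

theorem len_le_size (x : Data) : x.len ≤ x.size := by
  induction x with
  | nil => simp [len]
  | cons a b _ hb => simp only [len, size]; omega

@[simp] theorem fst_cons (a b : Data) : (cons a b).fst = a := rfl
@[simp] theorem snd_cons (a b : Data) : (cons a b).snd = b := rfl
@[simp] theorem toBit_nil : nil.toBit = false := rfl
@[simp] theorem toBit_cons (a b : Data) : (cons a b).toBit = true := rfl
@[simp] theorem toBit_ofBit (b : Bool) : (ofBit b).toBit = b := by cases b <;> rfl

theorem size_ofBit_le (b : Bool) : (ofBit b).size ≤ 3 := by cases b <;> simp [ofBit, size]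

@[simp] theorem toList_ofList (l : List Data) : (ofList l).toList = l := by
  induction l with
  | nil => rfl
  | cons a l ih => simp [ofList, toList, ih]

@[simp] theorem len_ofList (l : List Data) : (ofList l).len = l.length := by
  induction l with
  | nil => rfl
  | cons a l ih => simp [ofList, len, ih]

@[simp] theorem len_unary (n : ℕ) : (unary n).len = n := by simp [unary]

theorem unary_succ (n : ℕ) : unary (n + 1) = cons nil (unary n) := rfl

theorem size_unary (n : ℕ) : (unary n).size = 2 * n + 1 := by
  induction n with
  | zero => rfl
  | succ n ih => rw [unary_succ, size, ih, size]; ring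

theorem ofFn_zero (f : Fin 0 → Data) : ofFn f = nil := by simp [ofFn, ofList]

theorem ofFn_succ {n : ℕ} (f : Fin (n + 1) → Data) :
    ofFn f = cons (f 0) (ofFn fun i => f i.succ) := by
  simp [ofFn, List.ofFn_succ, ofList]

@[simp] theorem nth_ofFn {n : ℕ} (f : Fin n → Data) (i : Fin n) : (ofFn f).nth i = f i := by
  induction n with
  | zero => exact i.elim0
  | succ n ih =>
    rw [ofFn_succ]
    cases i using Fin.cases with
    | zero => rfl
    | succ i => exact ih (fun i => f i.succ) i

theorem nth_eq_iterate (x : Data) (k : ℕ) : x.nth k = (snd^[k] x).fst := by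
  induction k generalizing x with
  | zero => rfl
  | succ k ih => exact ih x.snd

theorem size_ofFn_le {n : ℕ} (f : Fin n → Data) (B : ℕ) (h : ∀ i, (f i).size ≤ B) :
    (ofFn f).size ≤ n * (B + 1) + 1 := by
  induction n with
  | zero => simp [ofFn_zero, size]
  | succ n ih =>
    have h1 := ih (fun i => f i.succ) fun i => h i.succ
    have h2 := h 0
    rw [ofFn_succ, size]
    linarith

theorem length_bits (x : Data) : x.bits.length = x.size := by
  induction x with
  | nil => rfl
  | cons a b ha hb => simp [bits, size, ha, hb]

theorem size_ofList_map_ofBit_le {α : Type} (l : List α) (f : α → Bool) :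
    (ofList (l.map fun a => ofBit (f a))).size ≤ 4 * l.length + 1 := by
  induction l with
  | nil => simp [ofList, size]
  | cons a l ih =>
    have := size_ofBit_le (f a)
    simp only [List.map_cons, ofList, size, List.length_cons]
    omega

theorem length_toList (x : Data) : x.toList.length = x.len := by
  induction x with
  | nil => rfl
  | cons a b _ ih => simp [toList, len, ih]

end Data

/-! ## Independent samples -/

namespace PMF

theorem bind_congr_support {α β : Type*} (p : PMF α) {f g : α → PMF β}
    (h : ∀ a ∈ p.support, f a = g a) : p.bind f = p.bind g := by
  ext b
  simp only [PMF.bind_apply]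
  refine tsum_congr fun a => ?_
  by_cases ha : a ∈ p.support
  · rw [h a ha]
  · rw [(PMF.apply_eq_zero_iff p a).mpr ha, zero_mul, zero_mul]

/-- An equality of differences, `f₁ - g₁ = g₂ - f₂`, survives averaging. It is written with sums
because subtraction in `ENNReal` truncates. -/
theorem bind_apply_add_bind_apply {α β : Type*} (p : PMF α) {f₁ f₂ g₁ g₂ : α → PMF β} (b : β)
    (h : ∀ a, f₁ a b + f₂ a b = g₁ a b + g₂ a b) :
    p.bind f₁ b + p.bind f₂ b = p.bind g₁ b + p.bind g₂ b := by
  simp only [PMF.bind_apply, ← ENNReal.tsum_add, ← mul_add, h]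

theorem uniformOfFintype_bind_equiv {α β : Type*} [Fintype α] [Nonempty α] (e : α ≃ α)
    (f : α → PMF β) :
    ((uniformOfFintype α).bind fun a => f (e a)) = (uniformOfFintype α).bind f := by
  ext b
  simp only [PMF.bind_apply, uniformOfFintype_apply]
  exact e.tsum_eq fun a => ((Fintype.card α : ENNReal))⁻¹ * f a b

end PMF

/-- The product formula frees the later arguments from the order of sampling in the recursive
definition. -/
theorem indep_apply {α : Type} {n : ℕ} (f : Fin n → PMF α) (r : Fin n → α) :
    indep n f r = ∏ i, f i (r i) := by
  classical
  induction n with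
  | zero =>
    have : r = Fin.elim0 := Subsingleton.elim _ _
    simp [indep, this]
  | succ n ih =>
    rw [indep, Fin.prod_univ_succ, PMF.bind_apply, tsum_eq_single (r 0)]
    · rw [PMF.bind_apply, tsum_eq_single fun i => r i.succ, ih, PMF.pure_apply, if_pos, mul_one]
      · exact (Fin.cons_self_tail r).symm
      · intro s hs
        rw [PMF.pure_apply, if_neg, mul_zero]
        intro h
        refine hs (funext fun i => ?_)
        simpa using (congrFun h i.succ).symm
    · intro a ha
      rw [PMF.bind_apply, ENNReal.tsum_eq_zero.mpr, mul_zero]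
      intro s
      rw [PMF.pure_apply, if_neg, mul_zero]
      rintro rfl
      exact ha (by simp)

theorem indep_bind_pure {α β : Type} {n : ℕ} (f : Fin n → PMF α) (φ : Fin n → α → β) :
    (indep n fun i => (f i).bind fun a => PMF.pure (φ i a)) =
      (indep n f).bind fun r => PMF.pure fun i => φ i (r i) := by
  induction n with
  | zero =>
    simp only [indep, PMF.pure_bind]
    congr 1
    exact Subsingleton.elim _ _
  | succ n ih =>
    simp only [indep, PMF.bind_bind, PMF.pure_bind, ih (fun i => f i.succ) fun i => φ i.succ]
    congr! 5 with a r
    ext i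
    cases i using Fin.cases <;> simp

theorem indep_pure {α : Type} {n : ℕ} (f : Fin n → α) :
    (indep n fun i => PMF.pure (f i)) = PMF.pure f := by
  induction n with
  | zero => simp only [indep]; congr 1; exact Subsingleton.elim _ _
  | succ n ih =>
    simp only [indep, PMF.pure_bind, ih fun i => f i.succ]
    congr 1
    exact Fin.cons_self_tail f

theorem indep_uniformOfFintype {α : Type} [Fintype α] [Nonempty α] (n : ℕ) :
    (indep n fun _ => PMF.uniformOfFintype α) = PMF.uniformOfFintype (Fin n → α) := by
  classical
  ext r
  simp [indep_apply, ENNReal.inv_pow]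

/-- Independent samples indexed by two numbers and a bit. -/
noncomputable def indepGrid {α : Type} (n l : ℕ) (f : Fin n → Fin l → Bool → PMF α) :
    PMF (Fin n → Fin l → Bool → α) :=
  indep n fun i => indep l fun j =>
    (f i j false).bind fun a => (f i j true).bind fun b =>
      PMF.pure fun c => if c then b else a

theorem indepGrid_apply {α : Type} {n l : ℕ} (f : Fin n → Fin l → Bool → PMF α)
    (r : Fin n → Fin l → Bool → α) :
    indepGrid n l f r = ∏ p : Fin n × Fin l × Bool, f p.1 p.2.1 p.2.2 (r p.1 p.2.1 p.2.2) := by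
  classical
  have pair : ∀ (p q : PMF α) (s : Bool → α), (p.bind fun a => q.bind fun b =>
      PMF.pure fun c => if c then b else a) s = p (s false) * q (s true) := by
    intro p q s
    have h : ∀ a b, (s = fun c => if c = true then b else a) ↔ s false = a ∧ s true = b := by
      intro a b
      constructor
      · rintro rfl; simp
      · rintro ⟨rfl, rfl⟩; ext c; cases c <;> rfl
    rw [PMF.bind_apply, tsum_eq_single (s false)]
    · rw [PMF.bind_apply, tsum_eq_single (s true)]
      · rw [PMF.pure_apply, if_pos ((h _ _).mpr ⟨rfl, rfl⟩), mul_one]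
      · intro b hb
        rw [PMF.pure_apply, if_neg fun hh => hb ((h _ _).mp hh).2.symm, mul_zero]
    · intro a ha
      rw [PMF.bind_apply, ENNReal.tsum_eq_zero.mpr, mul_zero]
      intro b
      rw [PMF.pure_apply, if_neg fun hh => ha ((h _ _).mp hh).1.symm, mul_zero]
  simp only [indepGrid, indep_apply, pair, Fintype.prod_prod_type, Fintype.prod_bool, mul_comm]

/-- In the reduction, this recovers the challenge key from the sampled family of keys. -/
theorem mem_support_of_indepGrid {α : Type} {n l : ℕ} {f : Fin n → Fin l → Bool → PMF α}
    {r : Fin n → Fin l → Bool → α} (h : r ∈ (indepGrid n l f).support) (i : Fin n) (j : Fin l)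
    (b : Bool) : r i j b ∈ (f i j b).support := by
  rw [PMF.mem_support_iff, indepGrid_apply] at h
  exact (PMF.mem_support_iff _ _).mpr (Finset.prod_ne_zero_iff.mp h (i, j, b) (Finset.mem_univ _))

theorem indepGrid_bind_pure {α β : Type} {n l : ℕ} (f : Fin n → Fin l → Bool → PMF α)
    (φ : Fin n → Fin l → Bool → α → β) :
    (indepGrid n l fun i j b => (f i j b).bind fun a => PMF.pure (φ i j b a)) =
      (indepGrid n l f).bind fun r => PMF.pure fun i j b => φ i j b (r i j b) := by
  unfold indepGrid
  rw [← indep_bind_pure _ fun i (s : Fin l → Bool → α) j b => φ i j b (s j b)]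
  congr! 2 with i
  rw [← indep_bind_pure _ fun j (s : Bool → α) b => φ i j b (s b)]
  congr! 2 with j
  simp only [PMF.bind_bind, PMF.pure_bind]
  congr! 5 with a b
  ext c
  cases c <;> rfl

/-- A random choice that affects one sample only may be made part of that sample. -/
theorem bind_indepGrid_ite {α β : Type} {n l : ℕ} (p : Fin n × Fin l × Bool) (D : PMF β)
    (h : β → PMF α) (f : Fin n → Fin l → Bool → PMF α) :
    (D.bind fun a => indepGrid n l fun i j b => if (i, j, b) = p then h a else f i j b) =
      indepGrid n l fun i j b => if (i, j, b) = p then D.bind h else f i j b := by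
  classical
  ext r
  -- In the product formula `q` enters through a single factor, so averaging over `D` acts on that
  -- factor alone.
  have key : ∀ q : PMF α, (indepGrid n l fun i j b => if (i, j, b) = p then q else f i j b) r =
      q (r p.1 p.2.1 p.2.2) *
        ∏ x ∈ Finset.univ.erase p, f x.1 x.2.1 x.2.2 (r x.1 x.2.1 x.2.2) := by
    intro q
    rw [indepGrid_apply, ← Finset.mul_prod_erase _ _ (Finset.mem_univ p), if_pos rfl]
    congr 1
    refine Finset.prod_congr rfl fun x hx => ?_
    rw [if_neg (show ¬ (x.1, x.2.1, x.2.2) = p from Finset.ne_of_mem_erase hx)]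
  rw [PMF.bind_apply, key]
  simp only [key, PMF.bind_apply, ← mul_assoc, ENNReal.tsum_mul_right]

/-! ## Denotational semantics of programs -/

namespace Code

/-- The effect of a loop on the accumulator and on the quantum memory. -/
noncomputable def denLoop (step : Data → Data → QState → PMF (Data × QState)) :
    Data → Data → QState → PMF (Data × QState)
  | .nil, s, ψ => PMF.pure (s, ψ)
  | .cons a l, s, ψ => (step a s ψ).bind fun r => denLoop step l r.1 r.2

/-- The joint distribution of the output and of the final quantum memory, without a clock. -/
noncomputable def den : Code → Data → QState → PMF (Data × QState)
  | .id, x, ψ => PMF.pure (x, ψ)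
  | .nil, _, ψ => PMF.pure (Data.nil, ψ)
  | .fst, x, ψ => PMF.pure (x.fst, ψ)
  | .snd, x, ψ => PMF.pure (x.snd, ψ)
  | .bits, x, ψ => PMF.pure (Data.ofList (x.bits.map Data.ofBit), ψ)
  | .pair f g, x, ψ => (den f x ψ).bind fun a => (den g x a.2).bind fun b =>
      PMF.pure (Data.cons a.1 b.1, b.2)
  | .comp f g, x, ψ => (den g x ψ).bind fun y => den f y.1 y.2
  | .ite c f g, x, ψ => (den c x ψ).bind fun b => if b.1.toBit then den f x b.2 else den g x b.2
  | .fold f, x, ψ => denLoop (fun a s => den f (Data.cons a s)) x.fst x.snd ψ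
  | .coin, _, ψ => (PMF.uniformOfFintype Bool).bind fun b => PMF.pure (Data.ofBit b, ψ)
  | .gate, x, ψ => PMF.pure (Data.nil, ψ.applyGate x.toGate)
  | .meas, x, ψ => (ψ.measure (x.toList.map Data.toWire).toFinset).bind fun r =>
      PMF.pure (Data.ofList (x.toList.map fun w => Data.ofBit (decide (w.toWire ∈ r.1))), r.2)

theorem tick_andThen {α : Type} (n : ℕ) (f : Unit → Comp α) (M : Machine) :
    (tick n).andThen f M = f () ⟨M.mem, M.time + n⟩ := by
  simp [tick, Comp.andThen]

theorem foldLoop_bind_pure {step : Data → Data → Comp Data}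
    {d : Data → Data → QState → PMF (Data × QState)}
    (h : ∀ a s M, ((step a s M).bind fun r => PMF.pure (r.1, r.2.mem)) = d a s M.mem)
    (l s : Data) (M : Machine) :
    ((foldLoop step l s M).bind fun r => PMF.pure (r.1, r.2.mem)) = denLoop d l s M.mem := by
  induction l generalizing s M with
  | nil => simp [foldLoop, denLoop, Comp.ret]
  | cons a l _ ih =>
    simp only [foldLoop, denLoop, Comp.andThen, PMF.bind_bind, ih, ← h, PMF.pure_bind]

/-- The recorded time never influences the computation, so forgetting it commutes with every
constructor. The induction is over all clock values because subprograms start late. -/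
theorem run_bind_pure (c : Code) (x : Data) (M : Machine) :
    ((c.run x M).bind fun r => PMF.pure (r.1, r.2.mem)) = c.den x M.mem := by
  induction c generalizing x M with
  | id | nil | fst | snd | bits => simp [run, tick_andThen, den, Comp.ret]
  | coin => simp [run, tick_andThen, den, tossCoin]
  | gate => simp [run, tick_andThen, den, gateStep]
  | meas => simp [run, tick_andThen, den, measStep]
  | pair f g hf hg =>
    have hg' : ∀ (a : Data) (M : Machine),
        ((g.run x M).bind fun r => PMF.pure (Data.cons a r.1, r.2.mem)) =
          (g.den x M.mem).bind fun r => PMF.pure (Data.cons a r.1, r.2) := by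
      intro a M
      simp [← hg]
    simp only [run, tick, den, Comp.andThen, Comp.ret, PMF.bind_bind, PMF.pure_bind, hg']
    -- `den` sees only the memory, so the machine may be replaced by the one whose clock has already
    -- advanced, to which `hf` applies.
    rw [show f.den x M.mem = f.den x (Machine.mk M.mem (M.time + (x.size + 1))).mem from rfl, ← hf]
    simp only [PMF.bind_bind, PMF.pure_bind]
  | comp f g hf hg =>
    simp only [run, tick, den, Comp.andThen, PMF.pure_bind, PMF.bind_bind, hf]
    rw [show g.den x M.mem = g.den x (Machine.mk M.mem (M.time + (x.size + 1))).mem from rfl, ← hg]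
    simp only [PMF.bind_bind, PMF.pure_bind]
  | ite c f g hc hf hg =>
    simp only [run, tick, den, Comp.andThen, PMF.pure_bind, PMF.bind_bind]
    rw [show c.den x M.mem = c.den x (Machine.mk M.mem (M.time + (x.size + 1))).mem from rfl, ← hc]
    simp only [PMF.bind_bind, PMF.pure_bind]
    congr 1
    ext1 r
    split_ifs
    · exact hf ..
    · exact hg ..
  | fold f hf =>
    simp only [run, tick_andThen, den]
    exact foldLoop_bind_pure (d := fun a s => f.den (Data.cons a s)) (fun a s M => hf _ M) _ _ _

theorem exec_eq_den (c : Code) (x : Data) (ψ : QState) : c.exec x ψ = c.den x ψ :=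
  run_bind_pure c x ⟨ψ, 0⟩

theorem mem_support_exec {c : Code} {x : Data} {M : Machine} {r : Data × Machine}
    (h : r ∈ (c.run x M).support) : (r.1, r.2.mem) ∈ (c.exec x M.mem).support := by
  rw [exec_eq_den, ← run_bind_pure c x M, PMF.mem_support_bind_iff]
  exact ⟨r, h, by simp⟩

variable (f g c : Code) (x : Data) (ψ : QState)

@[simp] theorem exec_id : Code.id.exec x ψ = PMF.pure (x, ψ) := exec_eq_den ..
@[simp] theorem exec_nil : Code.nil.exec x ψ = PMF.pure (Data.nil, ψ) := exec_eq_den ..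
@[simp] theorem exec_fst : Code.fst.exec x ψ = PMF.pure (x.fst, ψ) := exec_eq_den ..
@[simp] theorem exec_snd : Code.snd.exec x ψ = PMF.pure (x.snd, ψ) := exec_eq_den ..
@[simp] theorem exec_bits :
    Code.bits.exec x ψ = PMF.pure (Data.ofList (x.bits.map Data.ofBit), ψ) := exec_eq_den ..

@[simp] theorem exec_pair : (pair f g).exec x ψ =
    (f.exec x ψ).bind fun a => (g.exec x a.2).bind fun b => PMF.pure (Data.cons a.1 b.1, b.2) := by
  simp only [exec_eq_den, den]

@[simp] theorem exec_comp :
    (comp f g).exec x ψ = (g.exec x ψ).bind fun y => f.exec y.1 y.2 := by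
  simp only [exec_eq_den, den]

@[simp] theorem exec_ite : (ite c f g).exec x ψ =
    (c.exec x ψ).bind fun b => if b.1.toBit then f.exec x b.2 else g.exec x b.2 := by
  simp only [exec_eq_den, den]

variable {f} in
-- The body enters through any known closed form `step`, so that later computations need not unfold
-- `den`.
theorem exec_fold {step : Data → Data → QState → PMF (Data × QState)}
    (h : ∀ a s ψ, f.exec (Data.cons a s) ψ = step a s ψ) :
    (fold f).exec x ψ = denLoop step x.fst x.snd ψ := by
  rw [exec_eq_den, den]
  congr 1
  funext a s φ
  rw [← exec_eq_den, h]

@[simp] theorem exec_coin : Code.coin.exec x ψ =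
    (PMF.uniformOfFintype Bool).bind fun b => PMF.pure (Data.ofBit b, ψ) := exec_eq_den ..

@[simp] theorem exec_gate :
    Code.gate.exec x ψ = PMF.pure (Data.nil, ψ.applyGate x.toGate) := exec_eq_den ..

@[simp] theorem exec_meas : Code.meas.exec x ψ =
    (ψ.measure (x.toList.map Data.toWire).toFinset).bind fun r =>
      PMF.pure (Data.ofList (x.toList.map fun w => Data.ofBit (decide (w.toWire ∈ r.1))), r.2) :=
  exec_eq_den ..

theorem denLoop_classical {step : Data → Data → QState → PMF (Data × QState)}
    (h : ∀ a s, ∃ D : PMF Data, ∀ ψ, step a s ψ = D.bind fun b => PMF.pure (b, ψ)) (l s : Data) :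
    ∃ D : PMF Data, ∀ ψ, denLoop step l s ψ = D.bind fun b => PMF.pure (b, ψ) := by
  choose D hD using h
  induction l generalizing s with
  | nil => exact ⟨PMF.pure s, fun ψ => by simp [denLoop]⟩
  | cons a l _ ih =>
    choose E hE using ih
    exact ⟨(D a s).bind E, fun ψ => by simp [denLoop, hD, hE]⟩

variable {c}

/-- A classical program does not touch the quantum memory. -/
theorem Classical.exists_exec_eq (h : c.Classical) (x : Data) :
    ∃ D : PMF Data, ∀ ψ, c.exec x ψ = D.bind fun b => PMF.pure (b, ψ) := by
  induction c generalizing x with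
  | id => exact ⟨PMF.pure x, by simp⟩
  | nil => exact ⟨PMF.pure .nil, by simp⟩
  | fst => exact ⟨PMF.pure x.fst, by simp⟩
  | snd => exact ⟨PMF.pure x.snd, by simp⟩
  | bits => exact ⟨PMF.pure (Data.ofList (x.bits.map Data.ofBit)), by simp⟩
  | pair f g hf hg =>
    obtain ⟨D, hD⟩ := hf h.1 x
    obtain ⟨E, hE⟩ := hg h.2 x
    exact ⟨D.bind fun a => E.bind fun b => PMF.pure (.cons a b), by simp [hD, hE]⟩
  | comp f g hf hg =>
    obtain ⟨D, hD⟩ := hg h.2 x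
    choose E hE using hf h.1
    exact ⟨D.bind E, by simp [hD, hE]⟩
  | ite c f g hc hf hg =>
    obtain ⟨D, hD⟩ := hc h.1 x
    obtain ⟨E, hE⟩ := hf h.2.1 x
    obtain ⟨F, hF⟩ := hg h.2.2 x
    refine ⟨D.bind fun b => if b.toBit then E else F, fun ψ => ?_⟩
    simp only [exec_ite, hD, PMF.bind_bind, PMF.pure_bind, hE, hF]
    congr 1
    ext1 b
    split_ifs <;> rfl
  | fold f hf =>
    simp only [exec_fold _ _ fun _ _ _ => rfl]
    exact denLoop_classical (fun a s => hf h _) _ _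
  | coin => exact ⟨(PMF.uniformOfFintype Bool).bind fun b => PMF.pure (.ofBit b), by simp⟩
  | gate => exact h.elim
  | meas => exact h.elim

/-- `sample` runs on the zero memory. Since the output distribution does not depend on the memory,
it also describes key generation and encryption inside a program that holds the adversary's state.
-/
theorem Classical.exec_eq (h : c.Classical) (x : Data) (ψ : QState) :
    c.exec x ψ = (c.sample x).bind fun b => PMF.pure (b, ψ) := by
  obtain ⟨D, hD⟩ := h.exists_exec_eq x
  simp [sample, hD]

end Code

/-! ## Polynomial-time programs -/

/-- Let time `d` pass. -/
def Machine.delay (M : Machine) (d : ℕ) : Machine := ⟨M.mem, M.time + d⟩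

/-- The computation does not depend on the clock. -/
def Comp.ClockFree {α : Type} (C : Comp α) : Prop :=
  ∀ (M : Machine) (d : ℕ), C (M.delay d) = (C M).bind fun r => PMF.pure (r.1, r.2.delay d)

namespace Comp.ClockFree

theorem ret {α : Type} (a : α) : (Comp.ret a).ClockFree := fun M d => by simp [Comp.ret]

theorem andThen {α β : Type} {C : Comp α} {f : α → Comp β} (hC : C.ClockFree)
    (hf : ∀ a, (f a).ClockFree) : (C.andThen f).ClockFree := fun M d => by
  simp only [Comp.andThen, hC M d, PMF.bind_bind, PMF.pure_bind, hf _ _ d]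

end Comp.ClockFree

namespace Code

theorem clockFree_tick (n : ℕ) : (tick n).ClockFree := fun M d => by
  simp [tick, Machine.delay, Nat.add_right_comm]

theorem clockFree_foldLoop {step : Data → Data → Comp Data} (h : ∀ a s, (step a s).ClockFree)
    (l s : Data) : (foldLoop step l s).ClockFree := by
  induction l generalizing s with
  | nil => exact .ret s
  | cons a l _ ih => exact (h a s).andThen ih

theorem clockFree_run (c : Code) (x : Data) : (c.run x).ClockFree := by
  induction c generalizing x with
  | id | nil | fst | snd | bits => exact (clockFree_tick _).andThen fun _ => .ret _
  | pair f g hf hg =>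
    exact (clockFree_tick _).andThen fun _ => (hf x).andThen fun _ => (hg x).andThen fun _ => .ret _
  | comp f g hf hg => exact (clockFree_tick _).andThen fun _ => (hg x).andThen hf
  | ite c f g hc hf hg =>
    refine (clockFree_tick _).andThen fun _ => (hc x).andThen fun b => ?_
    cases b.toBit
    · exact hg x
    · exact hf x
  | fold f hf => exact (clockFree_tick _).andThen fun _ => clockFree_foldLoop (fun a s => hf _) _ _
  | coin =>
    refine (clockFree_tick _).andThen fun _ M d => ?_
    simp [tossCoin, Machine.delay]
  | gate =>
    refine (clockFree_tick _).andThen fun _ M d => ?_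
    simp [gateStep, Machine.delay]
  | meas =>
    refine (clockFree_tick _).andThen fun _ M d => ?_
    simp [measStep, Machine.delay]

theorem mem_support_andThen {α β : Type} {C : Comp α} {f : α → Comp β} {M : Machine}
    {r : β × Machine} :
    r ∈ (C.andThen f M).support ↔ ∃ s ∈ (C M).support, r ∈ (f s.1 s.2).support :=
  PMF.mem_support_bind_iff _ _ _

theorem mem_support_tick_andThen {β : Type} {n : ℕ} {f : Unit → Comp β} {M : Machine}
    {r : β × Machine} :
    r ∈ ((tick n).andThen f M).support ↔ r ∈ (f () ⟨M.mem, M.time + n⟩).support := by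
  rw [tick_andThen]

theorem mem_support_ret {α : Type} {a : α} {M : Machine} {r : α × Machine} :
    r ∈ (Comp.ret a M).support ↔ r = (a, M) := PMF.mem_support_pure_iff _ _

/-- On the input `x` the program halts within time `T`. -/
def HaltsIn (c : Code) (x : Data) (T : ℕ) : Prop :=
  ∀ M, ∀ r ∈ (c.run x M).support, r.2.time ≤ M.time + T

/-- `PolyTime` starts the clock at zero, whereas a subprogram starts at the time of its call. By
clock-freeness the time spent is the same, and the relative form is the one that composes. -/
theorem polyTime_iff {c : Code} :
    c.PolyTime ↔ ∃ p : Polynomial ℕ, ∀ x, c.HaltsIn x (p.eval x.size) := by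
  constructor
  · rintro ⟨p, hp⟩
    refine ⟨p, fun x M r hr => ?_⟩
    have e : M = (Machine.mk M.mem 0).delay M.time := by simp [Machine.delay]
    rw [e, clockFree_run c x, PMF.mem_support_bind_iff] at hr
    obtain ⟨s, hs, hr⟩ := hr
    rw [PMF.mem_support_pure_iff] at hr
    have := hp x _ s hs
    subst hr
    simp only [Machine.delay]
    omega
  · rintro ⟨p, hp⟩
    exact ⟨p, fun x ψ r hr => by simpa using hp x _ r hr⟩

/-- The bounds telescope: after one round the accumulator is paid for by the time of that round. The
term `s.size` is needed only for the empty loop, which returns `s` as it came. -/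
theorem time_le_and_size_le_foldLoop {step : Data → Data → Comp Data}
    (h : ∀ a s M, ∀ r ∈ (step a s M).support, r.1.size + 4 * M.time ≤ 4 * r.2.time)
    {l s : Data} {M : Machine} {r : Data × Machine} (hr : r ∈ (foldLoop step l s M).support) :
    M.time ≤ r.2.time ∧ r.1.size + 4 * M.time ≤ 4 * r.2.time + s.size := by
  induction l generalizing s M with
  | nil =>
    rw [foldLoop, mem_support_ret] at hr
    subst hr
    exact ⟨le_rfl, by simp only; omega⟩
  | cons a l _ ih =>
    rw [foldLoop, mem_support_andThen] at hr
    obtain ⟨t, ht, hr⟩ := hr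
    have h1 := h _ _ _ _ ht
    have h2 := ih hr
    omega

/-- A program cannot write more than four nodes per time step. -/
theorem size_add_le_of_mem_support_run {c : Code} {x : Data} {M : Machine} {r : Data × Machine}
    (hr : r ∈ (c.run x M).support) : r.1.size + 4 * M.time ≤ 4 * r.2.time := by
  have hb := fun b => Data.size_ofBit_le b
  induction c generalizing x M r with
  | id | nil =>
    rw [run, mem_support_tick_andThen, mem_support_ret] at hr
    subst hr
    simp only [Data.size]
    omega
  | fst =>
    rw [run, mem_support_tick_andThen, mem_support_ret] at hr
    subst hr
    have := x.size_fst_le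
    simp only
    omega
  | snd =>
    rw [run, mem_support_tick_andThen, mem_support_ret] at hr
    subst hr
    have := x.size_snd_le
    simp only
    omega
  | bits =>
    rw [run, mem_support_tick_andThen, mem_support_ret] at hr
    subst hr
    -- The factor 4 comes from here and from `meas`: a tree of `n` nodes becomes a list of `n` bits,
    -- with up to `4 * n + 1` nodes, at the cost `n + 1`.
    have := Data.size_ofList_map_ofBit_le x.bits _root_.id
    rw [Data.length_bits] at this
    simp only [id_eq] at this
    simp only
    have e : (Data.ofList (x.bits.map Data.ofBit)).size ≤ 4 * x.size + 1 := this
    omega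
  | pair f g hf hg =>
    rw [run, mem_support_tick_andThen, mem_support_andThen] at hr
    obtain ⟨s, hs, hr⟩ := hr
    obtain ⟨t, ht, hr⟩ := mem_support_andThen.mp hr
    rw [mem_support_ret] at hr
    subst hr
    have h1 := hf hs
    have h2 := hg ht
    simp only [Data.size] at h1 h2 ⊢
    omega
  | comp f g hf hg =>
    rw [run, mem_support_tick_andThen, mem_support_andThen] at hr
    obtain ⟨s, hs, hr⟩ := hr
    have h1 := hg hs
    have h2 := hf hr
    simp only at h1
    omega
  | ite c f g hc hf hg =>
    rw [run, mem_support_tick_andThen, mem_support_andThen] at hr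
    obtain ⟨s, hs, hr⟩ := hr
    have h1 := hc hs
    simp only at h1
    split_ifs at hr
    · have h2 := hf hr
      omega
    · have h2 := hg hr
      omega
  | fold f hf =>
    rw [run, mem_support_tick_andThen] at hr
    have h1 := time_le_and_size_le_foldLoop (fun a s M r hr => hf hr) hr
    have := x.size_snd_le
    simp only at h1
    omega
  | coin =>
    rw [run, mem_support_tick_andThen, tossCoin, PMF.mem_support_bind_iff] at hr
    obtain ⟨b, -, hr⟩ := hr
    rw [PMF.mem_support_pure_iff] at hr
    subst hr
    have := hb b
    have := x.one_le_size
    simp only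
    omega
  | gate =>
    rw [run, mem_support_tick_andThen, gateStep, PMF.mem_support_pure_iff] at hr
    subst hr
    simp only [Data.size]
    omega
  | meas =>
    rw [run, mem_support_tick_andThen, measStep, PMF.mem_support_bind_iff] at hr
    obtain ⟨b, -, hr⟩ := hr
    rw [PMF.mem_support_pure_iff] at hr
    subst hr
    have h1 := Data.size_ofList_map_ofBit_le x.toList fun w => decide (w.toWire ∈ b.1)
    have h2 := x.len_le_size
    rw [Data.length_toList] at h1
    simp only at h1 ⊢
    omega

theorem HaltsIn.size_le {c : Code} {x : Data} {T : ℕ} (h : c.HaltsIn x T) {M : Machine}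
    {r : Data × Machine} (hr : r ∈ (c.run x M).support) : r.1.size ≤ 4 * T := by
  have h1 := h M r hr
  have h2 := size_add_le_of_mem_support_run hr
  omega

theorem eval_mono (p : Polynomial ℕ) {a b : ℕ} (h : a ≤ b) : p.eval a ≤ p.eval b := by
  rw [Polynomial.eval_eq_sum, Polynomial.eval_eq_sum]
  exact Finset.sum_le_sum fun i _ => Nat.mul_le_mul_left _ (Nat.pow_le_pow_left h i)

theorem PolyTime.exists_size_le {c : Code} (h : c.PolyTime) :
    ∃ p : Polynomial ℕ, ∀ x ψ, ∀ r ∈ (c.exec x ψ).support, r.1.size ≤ p.eval x.size := by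
  obtain ⟨p, hp⟩ := polyTime_iff.mp h
  refine ⟨4 * p, fun x ψ r hr => ?_⟩
  rw [exec, PMF.mem_support_bind_iff] at hr
  obtain ⟨s, hs, hr⟩ := hr
  rw [PMF.mem_support_pure_iff] at hr
  subst hr
  simpa using (hp x).size_le hs

/-! ### Closure of polynomial time under the program constructors -/

namespace PolyTime

theorem of_tick {c : Code}
    (h : ∀ x M, ∀ r ∈ (c.run x M).support, r.2.time = M.time + (x.size + 1)) : c.PolyTime :=
  polyTime_iff.mpr ⟨Polynomial.X + 1, fun x M r hr => by simp [h x M r hr]⟩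

theorem id : Code.id.PolyTime := of_tick fun x M r hr => by
  rw [run, mem_support_tick_andThen, mem_support_ret] at hr; rw [hr]

theorem nil : Code.nil.PolyTime := of_tick fun x M r hr => by
  rw [run, mem_support_tick_andThen, mem_support_ret] at hr; rw [hr]

theorem fst : Code.fst.PolyTime := of_tick fun x M r hr => by
  rw [run, mem_support_tick_andThen, mem_support_ret] at hr; rw [hr]

theorem snd : Code.snd.PolyTime := of_tick fun x M r hr => by
  rw [run, mem_support_tick_andThen, mem_support_ret] at hr; rw [hr]

theorem bits : Code.bits.PolyTime := of_tick fun x M r hr => by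
  rw [run, mem_support_tick_andThen, mem_support_ret] at hr; rw [hr]

theorem coin : Code.coin.PolyTime := of_tick fun x M r hr => by
  rw [run, mem_support_tick_andThen, tossCoin, PMF.mem_support_bind_iff] at hr
  obtain ⟨b, -, hr⟩ := hr
  rw [(PMF.mem_support_pure_iff _ _).mp hr]

theorem gate : Code.gate.PolyTime := of_tick fun x M r hr => by
  rw [run, mem_support_tick_andThen, gateStep, PMF.mem_support_pure_iff] at hr; rw [hr]

theorem meas : Code.meas.PolyTime := of_tick fun x M r hr => by
  rw [run, mem_support_tick_andThen, measStep, PMF.mem_support_bind_iff] at hr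
  obtain ⟨b, -, hr⟩ := hr
  rw [(PMF.mem_support_pure_iff _ _).mp hr]

theorem pair {f g : Code} (hf : f.PolyTime) (hg : g.PolyTime) : (Code.pair f g).PolyTime := by
  obtain ⟨p, hp⟩ := polyTime_iff.mp hf
  obtain ⟨q, hq⟩ := polyTime_iff.mp hg
  refine polyTime_iff.mpr ⟨Polynomial.X + 1 + p + q, fun x M r hr => ?_⟩
  rw [run, mem_support_tick_andThen, mem_support_andThen] at hr
  obtain ⟨s, hs, hr⟩ := hr
  obtain ⟨t, ht, hr⟩ := mem_support_andThen.mp hr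
  rw [mem_support_ret] at hr
  subst hr
  have h1 := hp x _ _ hs
  have h2 := hq x _ _ ht
  simp only [Polynomial.eval_add, Polynomial.eval_X, Polynomial.eval_one] at h1 h2 ⊢
  omega

theorem comp {f g : Code} (hf : f.PolyTime) (hg : g.PolyTime) : (Code.comp f g).PolyTime := by
  obtain ⟨p, hp⟩ := polyTime_iff.mp hf
  obtain ⟨q, hq⟩ := polyTime_iff.mp hg
  -- A program running in time `q` outputs at most `4 * q` nodes, and this bounds the input of `f`.
  refine polyTime_iff.mpr ⟨Polynomial.X + 1 + q + p.comp (4 * q), fun x M r hr => ?_⟩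
  rw [run, mem_support_tick_andThen, mem_support_andThen] at hr
  obtain ⟨s, hs, hr⟩ := hr
  have h1 := hq x _ _ hs
  have h2 := hp _ _ _ hr
  have h3 := eval_mono p ((hq x).size_le hs)
  simp only [Polynomial.eval_add, Polynomial.eval_X, Polynomial.eval_one, Polynomial.eval_comp,
    Polynomial.eval_mul, Polynomial.eval_ofNat] at h1 h2 ⊢
  omega

theorem ite {c f g : Code} (hc : c.PolyTime) (hf : f.PolyTime) (hg : g.PolyTime) :
    (Code.ite c f g).PolyTime := by
  obtain ⟨o, ho⟩ := polyTime_iff.mp hc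
  obtain ⟨p, hp⟩ := polyTime_iff.mp hf
  obtain ⟨q, hq⟩ := polyTime_iff.mp hg
  refine polyTime_iff.mpr ⟨Polynomial.X + 1 + o + p + q, fun x M r hr => ?_⟩
  rw [run, mem_support_tick_andThen, mem_support_andThen] at hr
  obtain ⟨s, hs, hr⟩ := hr
  have h1 := ho x _ _ hs
  simp only [Polynomial.eval_add, Polynomial.eval_X, Polynomial.eval_one] at h1 ⊢
  split_ifs at hr
  · have h2 := hp x _ _ hr
    omega
  · have h2 := hq x _ _ hr
    omega

/-- A loop takes polynomial time if its body does and if the accumulator stays small. Here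
`Inv N k s` is an invariant of the accumulator `s` after `k` rounds on an input of size at most
`N`. -/
theorem fold {f : Code} (hf : f.PolyTime) (Inv : ℕ → ℕ → Data → Prop) (q : Polynomial ℕ)
    (h0 : ∀ N s, s.size ≤ N → Inv N 0 s)
    (hs : ∀ N k a s ψ, k < N → a.size ≤ N → Inv N k s →
      ∀ r ∈ (f.exec (Data.cons a s) ψ).support, Inv N (k + 1) r.1)
    (hq : ∀ N k s, k ≤ N → Inv N k s → s.size ≤ q.eval N) : (Code.fold f).PolyTime := by
  obtain ⟨p, hp⟩ := polyTime_iff.mp hf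
  -- `N` remains the size of the whole input. Each round shortens `l` by at least two nodes and
  -- raises `k` by one, so `l.size + k ≤ N` persists and bounds the round number; `l.size` also
  -- bounds the number of rounds left.
  have key : ∀ (N : ℕ) (l : Data) (k : ℕ) (s : Data) (M : Machine), l.size + k ≤ N → Inv N k s →
      ∀ r ∈ (foldLoop (fun a s => f.run (Data.cons a s)) l s M).support,
        r.2.time ≤ M.time + l.size * p.eval (N + q.eval N + 1) := by
    intro N l
    induction l with
    | nil =>
      intro k s M _ _ r hr
      rw [foldLoop, mem_support_ret] at hr
      subst hr
      exact Nat.le_add_right _ _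
    | cons a l _ ih =>
      intro k s M hk hi r hr
      rw [foldLoop, mem_support_andThen] at hr
      obtain ⟨t, ht, hr⟩ := hr
      simp only [Data.size] at hk
      have h1 := hp _ _ _ ht
      have h2 := ih (k + 1) t.1 t.2 (by omega)
        (hs N k a s M.mem (by omega) (by omega) hi _ (mem_support_exec ht)) r hr
      have h3 : (Data.cons a s).size ≤ N + q.eval N + 1 := by
        have := hq N k s (by omega) hi
        simp only [Data.size]
        omega
      have h4 := eval_mono p h3
      simp only [Data.size]
      nlinarith
  refine polyTime_iff.mpr ⟨Polynomial.X + 1 +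
    Polynomial.X * p.comp (Polynomial.X + q + 1), fun x M r hr => ?_⟩
  rw [run, mem_support_tick_andThen] at hr
  have h1 := key x.size x.fst 0 x.snd _ (by simpa using x.size_fst_le)
    (h0 _ _ x.size_snd_le) r hr
  have h2 := Nat.mul_le_mul_right (p.eval (x.size + q.eval x.size + 1)) x.size_fst_le
  simp only [Polynomial.eval_add, Polynomial.eval_X, Polynomial.eval_one, Polynomial.eval_comp,
    Polynomial.eval_mul] at h1 ⊢
  omega

end PolyTime

/-! ### Lists -/

/-- Reverse a list. -/
def rev : Code := comp (fold .id) (pair .id .nil)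

theorem PolyTime.rev : rev.PolyTime := by
  refine .comp (.fold .id (fun N k s => s.size ≤ N + k * (N + 1))
    (Polynomial.X + Polynomial.X * (Polynomial.X + 1)) ?_ ?_ ?_) (.pair .id .nil)
  · intro N s h
    simpa using h
  · intro N k a s ψ _ ha hs r hr
    rw [exec_id, PMF.mem_support_pure_iff] at hr
    subst hr
    simp only [Data.size]
    linarith
  · intro N k s hk hs
    simp only [Polynomial.eval_add, Polynomial.eval_X, Polynomial.eval_one, Polynomial.eval_mul]
    nlinarith

theorem denLoop_pure (step : Data → Data → Data) (l s : Data) (ψ : QState) :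
    denLoop (fun a s ψ => PMF.pure (step a s, ψ)) l s ψ =
      PMF.pure (l.toList.foldl (fun s a => step a s) s, ψ) := by
  induction l generalizing s with
  | nil => rfl
  | cons a l _ ih => simp [denLoop, ih, Data.toList]

theorem exec_rev (l : List Data) (ψ : QState) :
    rev.exec (Data.ofList l) ψ = PMF.pure (Data.ofList l.reverse, ψ) := by
  have h : ∀ l m : List Data,
      l.foldl (fun s a => Data.cons a s) (Data.ofList m) = Data.ofList (l.reverse ++ m) := by
    intro l
    induction l with
    | nil => intro m; rfl
    | cons a l ih => intro m; simpa [Data.ofList] using ih (a :: m)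
  have h' := h l []
  rw [List.append_nil] at h'
  simp only [rev, exec_comp, exec_pair, exec_id, exec_nil, PMF.pure_bind,
    exec_fold _ _ fun a s ψ => exec_id (Data.cons a s) ψ, denLoop_pure, Data.fst_cons,
    Data.snd_cons, Data.toList_ofList]
  exact congrArg (fun y => PMF.pure (y, ψ)) h'

/-- Entry of a list: maps `(1^k, x)` to the entry of `x` at position `k`. -/
def nth : Code := comp .fst (fold (comp .snd .snd))

theorem PolyTime.nth : nth.PolyTime := by
  refine .comp .fst (.fold (.comp .snd .snd) (fun N _ s => s.size ≤ N) Polynomial.X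
    (fun _ _ h => h) ?_ (by simp))
  intro N k a s ψ _ ha hs r hr
  simp only [exec_comp, exec_snd, PMF.pure_bind, PMF.mem_support_pure_iff] at hr
  subst hr
  exact s.size_snd_le.trans hs

@[simp] theorem exec_nth (k : ℕ) (x : Data) (ψ : QState) :
    nth.exec (Data.cons (Data.unary k) x) ψ = PMF.pure (x.nth k, ψ) := by
  have h : ∀ y : Data, (List.replicate k Data.nil).foldl (fun s _ => s.snd) y =
      Data.snd^[k] y := by
    induction k with
    | zero => intro y; rfl
    | succ k ih => intro y; simpa [List.replicate_succ] using ih y.snd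
  have e : ∀ a s ψ, (comp .snd .snd).exec (Data.cons a s) ψ = PMF.pure (s.snd, ψ) := by simp
  simp [nth, exec_fold _ _ e, denLoop_pure fun _ s => s.snd, Data.nth_eq_iterate, Data.unary, h]

/-- Does the list contain the bit `1`? -/
def any : Code := comp (fold (ite .fst (pair .nil .nil) .snd)) (pair .id .nil)

theorem PolyTime.any : any.PolyTime := by
  refine .comp (.fold (.ite .fst (.pair .nil .nil) .snd) (fun N _ s => s.size ≤ N + 3)
    (Polynomial.X + 3) (fun _ _ h => by omega) ?_ (by simp)) (.pair .id .nil)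
  intro N k a s ψ _ ha hs r hr
  simp only [exec_ite, exec_fst, exec_pair, exec_nil, exec_snd, PMF.pure_bind, Data.fst_cons,
    Data.snd_cons] at hr
  split_ifs at hr <;> rw [PMF.mem_support_pure_iff] at hr <;> subst hr
  · simp [Data.size]
  · exact hs

theorem exec_any {n : ℕ} (f : Fin n → Bool) (ψ : QState) :
    any.exec (Data.ofFn fun i => Data.ofBit (f i)) ψ =
      PMF.pure (Data.ofBit (decide (∃ i, f i = true)), ψ) := by
  have h : ∀ (n : ℕ) (f : Fin n → Bool) (b : Bool),
      denLoop (fun a s ψ => PMF.pure (if a.toBit then Data.ofBit true else s, ψ))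
        (Data.ofFn fun i => Data.ofBit (f i)) (Data.ofBit b) ψ =
      PMF.pure (Data.ofBit (b || decide (∃ i, f i = true)), ψ) := by
    intro n
    induction n with
    | zero => intro f b; simp [Data.ofFn_zero, denLoop]
    | succ n ih =>
      intro f b
      rw [Data.ofFn_succ, denLoop, PMF.pure_bind]
      have e : (if (Data.ofBit (f 0)).toBit then Data.ofBit true else Data.ofBit b) =
          Data.ofBit (b || f 0) := by
        cases f 0 <;> cases b <;> rfl
      simp only [e, ih (fun i => f i.succ), Fin.exists_fin_succ, Bool.or_assoc]
      simp
  have := h n f false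
  simp only [Bool.false_or] at this
  rw [← this]
  have e : ∀ a s ψ, (ite .fst (pair .nil .nil) .snd).exec (Data.cons a s) ψ =
      PMF.pure (if a.toBit then Data.ofBit true else s, ψ) := by
    intro a s ψ
    simp only [exec_ite, exec_fst, exec_pair, exec_nil, exec_snd, PMF.pure_bind, Data.fst_cons,
      Data.snd_cons]
    split_ifs <;> rfl
  simp only [any, exec_comp, exec_pair, exec_id, exec_nil, PMF.pure_bind, exec_fold _ _ e,
    Data.fst_cons, Data.snd_cons]
  rfl

/-- Apply a program to the entries of a list: maps `([a_0, a_1, ...], ctx)` to the list of the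
values of `g` on `(a_k, (ctx, 1^k))`. -/
def mapIdx (g : Code) : Code :=
  comp rev (comp (comp .snd .snd) (comp
    (fold (pair (comp .fst .snd) (pair (pair .nil (comp .fst (comp .snd .snd)))
      (pair (comp g (pair .fst (pair (comp .fst .snd) (comp .fst (comp .snd .snd)))))
        (comp .snd (comp .snd .snd))))))
    (pair .fst (pair .snd (pair .nil .nil)))))

theorem PolyTime.mapIdx {g : Code} (hg : g.PolyTime) : (mapIdx g).PolyTime := by
  obtain ⟨p, hp⟩ := hg.exists_size_le
  -- The accumulator is `(ctx, (1^k, results))`, with the results in reverse order. Since `k < N`,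
  -- the program `g` receives at most `N + N + (N + 2 * k) + 2 ≤ 5 * N + 2` nodes, which explains
  -- the argument of `p`.
  refine .comp .rev (.comp (.comp .snd .snd) (.comp (.fold ?_
    (fun N k s => s.fst.size ≤ N ∧ s.snd.fst.size ≤ N + 2 * k ∧
      s.snd.snd.size ≤ N + k * (p.eval (5 * N + 2) + 1))
    (Polynomial.X + 3 * Polynomial.X +
      (Polynomial.X + Polynomial.X * (p.comp (5 * Polynomial.X + 2) + 1)) + 2)
    ?_ ?_ ?_) (.pair .fst (.pair .snd (.pair .nil .nil)))))
  · exact .pair (.comp .fst .snd) (.pair (.pair .nil (.comp .fst (.comp .snd .snd)))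
      (.pair (.comp hg (.pair .fst (.pair (.comp .fst .snd) (.comp .fst (.comp .snd .snd)))))
        (.comp .snd (.comp .snd .snd))))
  · intro N s h
    have h1 := s.size_fst_le
    have h2 := s.size_snd_le
    have h3 := s.snd.size_fst_le
    have h4 := s.snd.size_snd_le
    refine ⟨?_, ?_, ?_⟩ <;> omega
  · intro N k a s ψ hk ha ⟨h1, h2, h3⟩ r hr
    simp only [exec_pair, exec_comp, exec_fst, exec_snd, exec_nil, PMF.pure_bind, Data.fst_cons,
      Data.snd_cons, PMF.bind_bind, PMF.mem_support_bind_iff, PMF.mem_support_pure_iff] at hr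
    obtain ⟨t, ht, rfl⟩ := hr
    have h4 := (hp _ _ _ ht).trans (eval_mono p (b := 5 * N + 2) (by simp only [Data.size]; omega))
    simp only [Data.fst_cons, Data.snd_cons, Data.size]
    refine ⟨h1, by omega, ?_⟩
    linarith
  · intro N k s hk ⟨h1, h2, h3⟩
    have h4 := s.size_le_fst_add_snd
    have h5 := s.snd.size_le_fst_add_snd
    have h6 := Nat.mul_le_mul_right (p.eval (5 * N + 2) + 1) hk
    simp only [Polynomial.eval_add, Polynomial.eval_X, Polynomial.eval_one, Polynomial.eval_comp,
      Polynomial.eval_mul, Polynomial.eval_ofNat]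
    omega

/-- Run a family of programs on the entries of a list. -/
noncomputable def seqList (E : ℕ → Data → QState → PMF (Data × QState)) :
    ℕ → List Data → QState → PMF (List Data × QState)
  | _, [], ψ => PMF.pure ([], ψ)
  | k, a :: l, ψ => (E k a ψ).bind fun r => (seqList E (k + 1) l r.2).bind fun s =>
      PMF.pure (r.1 :: s.1, s.2)

theorem exec_mapIdx (g : Code) (l ctx : Data) (ψ : QState) :
    (mapIdx g).exec (Data.cons l ctx) ψ =
      (seqList (fun k a => g.exec (Data.cons a (Data.cons ctx (Data.unary k)))) 0 l.toList ψ).bind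
        fun r => PMF.pure (Data.ofList r.1, r.2) := by
  -- The induction needs an arbitrary start of the counter and arbitrary earlier results, which the
  -- new ones precede in reverse.
  have key : ∀ (l : Data) (k : ℕ) (res : List Data) (ψ : QState),
      denLoop (fun a s ψ =>
        (g.exec (Data.cons a (Data.cons s.fst s.snd.fst)) ψ).bind fun r => PMF.pure
          (Data.cons s.fst (Data.cons (Data.cons .nil s.snd.fst) (Data.cons r.1 s.snd.snd)), r.2))
        l (Data.cons ctx (Data.cons (Data.unary k) (Data.ofList res))) ψ =
      (seqList (fun k a => g.exec (Data.cons a (Data.cons ctx (Data.unary k)))) k l.toList ψ).bind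
        fun r => PMF.pure (Data.cons ctx (Data.cons (Data.unary (k + l.len))
          (Data.ofList (r.1.reverse ++ res))), r.2) := by
    intro l
    induction l with
    | nil => intro k res ψ; simp [denLoop, seqList, Data.toList, Data.len]
    | cons a l _ ih =>
      intro k res ψ
      simp only [denLoop, seqList, Data.toList, PMF.bind_bind, PMF.pure_bind, Data.fst_cons,
        Data.snd_cons]
      congr 1
      funext r
      have := ih (k + 1) (r.1 :: res) r.2
      simp only [Data.unary_succ, Data.ofList] at this
      rw [this]
      simp only [Data.len, Nat.add_comm, Nat.add_left_comm, List.reverse_cons,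
        List.append_assoc, List.singleton_append]
  have e : ∀ a s ψ, (pair (comp .fst .snd) (pair (pair .nil (comp .fst (comp .snd .snd)))
      (pair (comp g (pair .fst (pair (comp .fst .snd) (comp .fst (comp .snd .snd)))))
        (comp .snd (comp .snd .snd))))).exec (Data.cons a s) ψ =
      (g.exec (Data.cons a (Data.cons s.fst s.snd.fst)) ψ).bind fun r => PMF.pure
        (Data.cons s.fst (Data.cons (Data.cons .nil s.snd.fst) (Data.cons r.1 s.snd.snd)),
          r.2) := by
    simp
  have := key l 0 [] ψ
  simp only [show Data.unary 0 = .nil from rfl, Data.ofList] at this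
  simp only [mapIdx, exec_comp, exec_pair, exec_fst, exec_snd, exec_nil, PMF.pure_bind,
    Data.fst_cons, Data.snd_cons, PMF.bind_bind, exec_fold _ _ e, this]
  simp [exec_rev]

end Code

/-! ## Families of programs on lists and grids -/

/-- Run a family of computations one after the other. -/
noncomputable def seqFin {α : Type} : (n : ℕ) → (Fin n → QState → PMF (α × QState)) →
    QState → PMF ((Fin n → α) × QState)
  | 0, _, ψ => PMF.pure (Fin.elim0, ψ)
  | n + 1, E, ψ => (E 0 ψ).bind fun r => (seqFin n (fun i => E i.succ) r.2).bind fun s =>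
      PMF.pure (Fin.cons r.1 s.1, s.2)

/-- Computations that leave the quantum memory untouched cannot influence each other, so running
them in sequence is independent sampling. -/
theorem seqFin_eq_indep {α β : Type} {n : ℕ} {E : Fin n → QState → PMF (β × QState)}
    {D : Fin n → PMF α} {h : Fin n → α → β}
    (hE : ∀ i ψ, E i ψ = (D i).bind fun a => PMF.pure (h i a, ψ)) (ψ : QState) :
    seqFin n E ψ = (indep n D).bind fun r => PMF.pure (fun i => h i (r i), ψ) := by
  induction n with
  | zero =>
    simp only [seqFin, indep, PMF.pure_bind]
    congr 2
    exact Subsingleton.elim _ _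
  | succ n ih =>
    simp only [seqFin, indep, PMF.bind_bind, PMF.pure_bind, hE 0,
      ih (E := fun i => E i.succ) (D := fun i => D i.succ) (h := fun i => h i.succ)
        fun i => hE i.succ]
    congr! 6 with a r
    ext i
    cases i using Fin.cases <;> simp

namespace Code

theorem seqList_ofFn {n : ℕ} (E : ℕ → Data → QState → PMF (Data × QState)) (k : ℕ)
    (f : Fin n → Data) (ψ : QState) :
    seqList E k (List.ofFn f) ψ =
      (seqFin n (fun i => E (k + i) (f i)) ψ).bind fun r => PMF.pure (List.ofFn r.1, r.2) := by
  induction n generalizing k ψ with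
  | zero => simp [seqList, seqFin]
  | succ n ih =>
    simp only [List.ofFn_succ, seqList, seqFin, ih, PMF.bind_bind, PMF.pure_bind, Fin.cons_zero,
      Fin.cons_succ, Fin.val_zero, Fin.val_succ, add_zero, Nat.add_right_comm k 1, Nat.add_assoc k]

theorem exec_mapIdx_ofFn (g : Code) {n : ℕ} (f : Fin n → Data) (ctx : Data) (ψ : QState) :
    (mapIdx g).exec (Data.cons (Data.ofFn f) ctx) ψ =
      (seqFin n (fun i => g.exec (Data.cons (f i) (Data.cons ctx (Data.unary i)))) ψ).bind
        fun r => PMF.pure (Data.ofFn r.1, r.2) := by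
  rw [exec_mapIdx, Data.ofFn, Data.toList_ofList, seqList_ofFn]
  simp only [PMF.bind_bind, PMF.pure_bind, zero_add]
  rfl

theorem exec_mapIdx_eq_indep {g : Code} {α : Type} {n : ℕ} {f : Fin n → Data} {ctx : Data}
    {D : Fin n → PMF α} {h : Fin n → α → Data}
    (hE : ∀ i ψ, g.exec (Data.cons (f i) (Data.cons ctx (Data.unary i))) ψ =
      (D i).bind fun a => PMF.pure (h i a, ψ)) (ψ : QState) :
    (mapIdx g).exec (Data.cons (Data.ofFn f) ctx) ψ =
      (indep n D).bind fun r => PMF.pure (Data.ofFn fun i => h i (r i), ψ) := by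
  rw [exec_mapIdx_ofFn, seqFin_eq_indep hE]
  simp only [PMF.bind_bind, PMF.pure_bind]

theorem exec_mapIdx_eq_pure {g : Code} {n : ℕ} {f : Fin n → Data} {ctx : Data}
    {h : Fin n → Data}
    (hE : ∀ i ψ, g.exec (Data.cons (f i) (Data.cons ctx (Data.unary i))) ψ = PMF.pure (h i, ψ))
    (ψ : QState) :
    (mapIdx g).exec (Data.cons (Data.ofFn f) ctx) ψ = PMF.pure (Data.ofFn h, ψ) := by
  rw [exec_mapIdx_eq_indep (D := fun i => PMF.pure (h i)) (h := fun _ a => a)]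
  · simp only [indep_pure, PMF.pure_bind]
  · intro i ψ
    rw [hE, PMF.pure_bind]

/-! ### Loops over lists of lists -/

/-- A list of lists. -/
def _root_.Data.grid {n l : ℕ} (f : Fin n → Fin l → Data) : Data :=
  Data.ofFn fun i => Data.ofFn (f i)

@[simp] theorem _root_.Data.nth_nth_grid {n l : ℕ} (f : Fin n → Fin l → Data) (i : Fin n)
    (j : Fin l) : ((Data.grid f).nth i).nth j = f i j := by
  simp [Data.grid]

/-- Apply a program to the entries of a list of lists, together with a context and with the two
positions of the entry. -/
def mapGrid (g : Code) : Code := mapIdx (mapIdx g)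

theorem PolyTime.mapGrid {g : Code} (hg : g.PolyTime) : (mapGrid g).PolyTime := hg.mapIdx.mapIdx

/-- The input of a program that `mapGrid` applies to an entry. -/
abbrev gridEnv (a ctx : Data) (i j : ℕ) : Data :=
  Data.cons a (Data.cons (Data.cons ctx (Data.unary i)) (Data.unary j))

theorem exec_mapGrid (g : Code) {n l : ℕ} (f : Fin n → Fin l → Data) (ctx : Data) (ψ : QState) :
    (mapGrid g).exec (Data.cons (Data.grid f) ctx) ψ =
      (seqFin n (fun i => seqFin l fun j => g.exec (gridEnv (f i j) ctx i j)) ψ).bind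
        fun r => PMF.pure (Data.grid r.1, r.2) := by
  have h : ∀ (n : ℕ) (E : Fin n → QState → PMF ((Fin l → Data) × QState)) (ψ : QState),
      seqFin n (fun i ψ => (E i ψ).bind fun r => PMF.pure (Data.ofFn r.1, r.2)) ψ =
        (seqFin n E ψ).bind fun r => PMF.pure (fun i => Data.ofFn (r.1 i), r.2) := by
    intro n
    induction n with
    | zero =>
      intro E ψ
      simp only [seqFin, PMF.pure_bind]
      congr 2
      exact Subsingleton.elim _ _
    | succ n ih =>
      intro E ψ
      simp only [seqFin, PMF.bind_bind, PMF.pure_bind, ih]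
      congr! 6 with a r
      ext i
      cases i using Fin.cases <;> simp
  have e : (fun i : Fin n => (mapIdx g).exec
      (Data.cons (Data.ofFn (f i)) (Data.cons ctx (Data.unary i)))) = fun i ψ =>
      (seqFin l (fun j => g.exec (gridEnv (f i j) ctx i j)) ψ).bind
        fun r => PMF.pure (Data.ofFn r.1, r.2) := by
    funext i ψ
    exact exec_mapIdx_ofFn ..
  rw [mapGrid, Data.grid, exec_mapIdx_ofFn, e, h]
  simp only [PMF.bind_bind, PMF.pure_bind, Data.grid]

theorem exec_mapGrid_eq_indep {g : Code} {α : Type} {n l : ℕ} {f : Fin n → Fin l → Data}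
    {ctx : Data} {D : Fin n → Fin l → PMF α} {h : Fin n → Fin l → α → Data}
    (hE : ∀ i j ψ, g.exec (gridEnv (f i j) ctx i j) ψ =
      (D i j).bind fun a => PMF.pure (h i j a, ψ)) (ψ : QState) :
    (mapGrid g).exec (Data.cons (Data.grid f) ctx) ψ =
      (indep n fun i => indep l (D i)).bind fun r =>
        PMF.pure (Data.grid fun i j => h i j (r i j), ψ) := by
  rw [mapGrid, Data.grid,
    exec_mapIdx_eq_indep (D := fun i => indep l (D i))
      (h := fun i r => Data.ofFn fun j => h i j (r j))]
  · rfl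
  · exact fun i ψ => exec_mapIdx_eq_indep (hE i) ψ

theorem exec_mapGrid_eq_pure {g : Code} {n l : ℕ} {f : Fin n → Fin l → Data}
    {ctx : Data} {h : Fin n → Fin l → Data}
    (hE : ∀ i j ψ, g.exec (gridEnv (f i j) ctx i j) ψ = PMF.pure (h i j, ψ)) (ψ : QState) :
    (mapGrid g).exec (Data.cons (Data.grid f) ctx) ψ = PMF.pure (Data.grid h, ψ) :=
  exec_mapIdx_eq_pure (fun i ψ => exec_mapIdx_eq_pure (hE i) ψ) ψ

theorem exec_mapGrid_eq_indepGrid {g : Code} {α : Type} {n l : ℕ} {f : Fin n → Fin l → Data}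
    {ctx : Data} {D : Fin n → Fin l → Bool → PMF α} {h : Fin n → Fin l → α → α → Data}
    (hE : ∀ i j ψ, g.exec (gridEnv (f i j) ctx i j) ψ =
      (D i j false).bind fun a => (D i j true).bind fun b => PMF.pure (h i j a b, ψ))
    (ψ : QState) :
    (mapGrid g).exec (Data.cons (Data.grid f) ctx) ψ =
      (indepGrid n l D).bind fun r =>
        PMF.pure (Data.grid fun i j => h i j (r i j false) (r i j true), ψ) := by
  rw [exec_mapGrid_eq_indep (h := fun i j (s : Bool → α) => h i j (s false) (s true))]
  · rfl
  · intro i j ψ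
    rw [hE]
    simp

/-! ### Lookups by position and Boolean operations -/

/-- In a program that `mapGrid` applies to an entry: the context. -/
def ctx : Code := comp .fst (comp .fst .snd)

/-- The entry of a list of lists at the position of the current entry. -/
def lookup (c : Code) : Code :=
  comp nth (pair (comp .snd .snd) (comp nth (pair (comp .snd (comp .fst .snd)) c)))

theorem PolyTime.ctx : ctx.PolyTime := .comp .fst (.comp .fst .snd)

theorem PolyTime.lookup {c : Code} (hc : c.PolyTime) : (lookup c).PolyTime :=
  .comp .nth (.pair (.comp .snd .snd) (.comp .nth (.pair (.comp .snd (.comp .fst .snd)) hc)))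

@[simp] theorem exec_ctx (a x : Data) (i j : ℕ) (ψ : QState) :
    ctx.exec (gridEnv a x i j) ψ = PMF.pure (x, ψ) := by
  simp [ctx]

@[simp] theorem exec_lookup (c : Code) (a x : Data) (i j : ℕ) (ψ : QState) :
    (lookup c).exec (gridEnv a x i j) ψ =
      (c.exec (gridEnv a x i j) ψ).bind fun r => PMF.pure ((r.1.nth i).nth j, r.2) := by
  simp [lookup]

/-- The negation of a bit. -/
def not (c : Code) : Code := ite c .nil (pair .nil .nil)

/-- The exclusive disjunction of two bits, the second of which is normalized. -/
def xor (c d : Code) : Code := ite c (not d) d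

theorem PolyTime.not {c : Code} (hc : c.PolyTime) : (not c).PolyTime :=
  .ite hc .nil (.pair .nil .nil)

theorem PolyTime.xor {c d : Code} (hc : c.PolyTime) (hd : d.PolyTime) : (xor c d).PolyTime :=
  .ite hc hd.not hd

@[simp] theorem exec_not (c : Code) (x : Data) (ψ : QState) :
    (not c).exec x ψ = (c.exec x ψ).bind fun r => PMF.pure (Data.ofBit (!r.1.toBit), r.2) := by
  simp only [not, exec_ite, exec_nil, exec_pair, PMF.pure_bind]
  congr! 2 with r
  cases r.1.toBit <;> rfl

theorem exec_xor {c d : Code} {x : Data} {b : Bool}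
    (hd : ∀ ψ, d.exec x ψ = PMF.pure (Data.ofBit b, ψ)) (ψ : QState) :
    (xor c d).exec x ψ =
      (c.exec x ψ).bind fun r => PMF.pure (Data.ofBit (r.1.toBit ^^ b), r.2) := by
  simp only [xor, exec_ite, exec_not, hd, PMF.pure_bind, Data.toBit_ofBit]
  congr! 2 with r
  cases r.1.toBit <;> simp

end Code

/-! ## Reading the output register wire by wire -/

namespace QState

theorem born_apply (ψ : QState) (s : Finset Wire) :
    ψ.born s = ENNReal.ofReal (‖ψ.amp s‖ ^ 2) := rfl

/-- The computation measures qubits in such a way that a subsequent measurement of all qubits in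
the computational basis gives an `s` for which it has returned `ρ s`. -/
def Reads {α : Type} (E : QState → PMF (α × QState)) (ρ : Finset Wire → α) : Prop :=
  ∀ ψ, ((E ψ).bind fun r => r.2.born.bind fun s => PMF.pure (r.1, s)) =
    ψ.born.bind fun s => PMF.pure (ρ s, s)

open Classical in
-- The outcome `o` has as its probability the squared norm of the projected vector `v`, and the
-- collapse divides by exactly this number. The product is the unnormalized weight `‖v t‖ ^ 2`,
-- which is the Born weight of `t` in the original state if `t ∩ W = o` and zero otherwise.
theorem reads_measure (W : Finset Wire) : Reads (measure W) fun s => s ∩ W := by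
  intro ψ
  have born_bind : ∀ (φ : QState) (f : Finset Wire → Finset Wire) (o t : Finset Wire),
      (φ.born.bind fun s => PMF.pure (f s, s)) (o, t) = if f t = o then φ.born t else 0 := by
    intro φ f o t
    rw [PMF.bind_apply, tsum_eq_single t]
    · rw [PMF.pure_apply]
      split_ifs with h1 h2 h2 <;> simp_all
    · intro s hs
      rw [PMF.pure_apply, if_neg, mul_zero]
      rintro h
      exact hs (Prod.ext_iff.mp h).2.symm
  ext ⟨o, t⟩
  rw [born_bind]
  simp only [measure, PMF.bind_bind, PMF.pure_bind]
  rw [PMF.bind_apply]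
  simp only [born_bind]
  have term : ∀ s, (ψ.born s * if s ∩ W = o then (ψ.collapse W (s ∩ W)).born t else 0) =
      (if s ∩ W = o then ψ.born s else 0) * (ψ.collapse W o).born t := by
    intro s
    split_ifs with h
    · rw [h]
    · simp
  simp only [term, ENNReal.tsum_mul_right]
  set v : QVec := ψ.amp.filter fun s => s ∩ W = o with hv
  have hsum : (∑' s, if s ∩ W = o then ψ.born s else 0) = ENNReal.ofReal v.normSq := by
    have e : ∀ s, (if s ∩ W = o then ψ.born s else 0) = ENNReal.ofReal (‖v s‖ ^ 2) := by
      intro s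
      rw [hv, Finsupp.filter_apply]
      split_ifs <;> simp [born_apply]
    rw [QVec.normSq_eq_tsum, ENNReal.ofReal_tsum_of_nonneg (fun _ => by positivity) v.summable]
    exact tsum_congr e
  have hvt : ENNReal.ofReal (‖v t‖ ^ 2) = if t ∩ W = o then ψ.born t else 0 := by
    rw [hv, Finsupp.filter_apply]
    split_ifs <;> simp [born_apply]
  rw [hsum, ← hvt]
  by_cases h : v.normSq = 0
  -- For an outcome of probability zero `collapse` keeps the state, but then `v` vanishes and both
  -- sides are zero.
  · have h0 : ‖v t‖ ^ 2 = 0 := by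
      rw [QVec.normSq_eq_tsum] at h
      exact (hasSum_zero_iff_of_nonneg (fun s => by positivity)).mp
        (h ▸ v.summable.hasSum) |> fun h => congrFun h t
    simp [h, h0]
  · have hc : (ψ.collapse W o).amp = (((Real.sqrt v.normSq)⁻¹ : ℝ) : ℂ) • v := by
      rw [collapse]
      exact congrArg QState.amp (dif_neg h)
    rw [born_apply, hc, ← ENNReal.ofReal_mul v.normSq_nonneg, Finsupp.smul_apply, norm_smul,
      mul_pow, Complex.norm_real, Real.norm_eq_abs, sq_abs, inv_pow, Real.sq_sqrt v.normSq_nonneg,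
      ← mul_assoc, mul_inv_cancel₀ h, one_mul]

theorem Reads.bind_pure {α β : Type} {E : QState → PMF (α × QState)} {ρ : Finset Wire → α}
    (hE : Reads E ρ) (h : α → β) :
    Reads (fun ψ => (E ψ).bind fun r => PMF.pure (h r.1, r.2)) fun s => h (ρ s) := by
  intro ψ
  have := congrArg (fun p => p.bind fun r => PMF.pure (h r.1, r.2)) (hE ψ)
  simpa only [PMF.bind_bind, PMF.pure_bind] using this

theorem Reads.fst {α : Type} {E : QState → PMF (α × QState)} {ρ : Finset Wire → α}
    (hE : Reads E ρ) (ψ : QState) :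
    ((E ψ).bind fun r => PMF.pure r.1) = ψ.born.bind fun s => PMF.pure (ρ s) := by
  have := congrArg (fun p => p.bind fun r => PMF.pure r.1) (hE ψ)
  simpa only [PMF.bind_bind, PMF.pure_bind, PMF.bind_const] using this

/-- By induction the later computations followed by a complete measurement act like a complete
measurement of the state left by the first one, to which the hypothesis on the first one applies.
Only classical distributions are compared, never collapsed states. -/
theorem Reads.seqFin {α : Type} {n : ℕ} {E : Fin n → QState → PMF (α × QState)}
    {ρ : Fin n → Finset Wire → α} (hE : ∀ i, Reads (E i) (ρ i)) :
    Reads (seqFin n E) fun s i => ρ i s := by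
  induction n with
  | zero =>
    intro ψ
    simp only [_root_.seqFin, PMF.pure_bind]
    congr! 4
  | succ n ih =>
    intro ψ
    have h1 := ih (E := fun i => E i.succ) fun i => hE i.succ
    have h2 : ∀ (a : α) φ, ((_root_.seqFin n (fun i => E i.succ) φ).bind fun r =>
        r.2.born.bind fun s => PMF.pure ((Fin.cons a r.1 : Fin (n + 1) → α), s)) =
        φ.born.bind fun s => PMF.pure (Fin.cons a fun i => ρ i.succ s, s) := by
      intro a φ
      have := congrArg (fun p => p.bind fun r =>
        PMF.pure ((Fin.cons a r.1 : Fin (n + 1) → α), r.2)) (h1 φ)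
      simpa only [PMF.bind_bind, PMF.pure_bind] using this
    simp only [_root_.seqFin, PMF.bind_bind, PMF.pure_bind, h2]
    have := congrArg (fun p => p.bind fun r =>
      PMF.pure ((Fin.cons r.1 fun i => ρ i.succ r.2 : Fin (n + 1) → α), r.2)) (hE 0 ψ)
    simp only [PMF.bind_bind, PMF.pure_bind] at this
    rw [this]
    refine congrArg _ (funext fun s => congrArg PMF.pure (Prod.ext (funext fun i => ?_) rfl))
    cases i using Fin.cases <;> simp

end QState

/-! ## Running the adversary's circuit -/

namespace Code

/-- Write a tree into the ciphertext register. -/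
def load : Code :=
  comp (mapIdx (ite .fst (comp .gate (pair (pair .nil (pair .nil .nil))
    (pair (pair .nil .nil) (comp .snd .snd)))) .nil)) (pair .bits .nil)

/-- Apply a circuit. -/
def circuit : Code := comp (fold (comp .gate .fst)) (pair .id .nil)

theorem PolyTime.load : load.PolyTime :=
  .comp (.mapIdx (.ite .fst (.comp .gate (.pair (.pair .nil (.pair .nil .nil))
    (.pair (.pair .nil .nil) (.comp .snd .snd)))) .nil)) (.pair .bits .nil)

theorem PolyTime.circuit : circuit.PolyTime := by
  refine .comp (.fold (.comp .gate .fst) (fun N _ s => s.size ≤ N + 1)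
    (Polynomial.X + 1) (fun _ _ h => by omega) ?_ (by simp)) (.pair .id .nil)
  intro N k a s ψ _ ha hs r hr
  simp only [exec_comp, exec_fst, exec_gate, PMF.pure_bind, PMF.mem_support_pure_iff] at hr
  subst hr
  simp [Data.size]

theorem exec_load (x : Data) (ψ : QState) :
    ∃ y, load.exec x ψ = PMF.pure (y, ψ.load x.bits) := by
  have key : ∀ (l : List Bool) (k : ℕ) (ψ : QState), seqList
      (fun k a => (ite .fst (comp .gate (pair (pair .nil (pair .nil .nil))
        (pair (pair .nil .nil) (comp .snd .snd)))) .nil).exec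
          (Data.cons a (Data.cons .nil (Data.unary k)))) k (l.map Data.ofBit) ψ =
      PMF.pure (l.map fun _ => Data.nil, (l.zipIdx k).foldl
        (fun φ p => if p.1 then φ.applyGate (.not (.inp p.2)) else φ) ψ) := by
    intro l
    induction l with
    | nil => intro k ψ; rfl
    | cons b l ih =>
      intro k ψ
      rw [List.map_cons, seqList]
      cases b <;> simp [ih, Data.toGate, Data.toWire, Data.len]
  refine ⟨Data.ofList (x.bits.map fun _ => Data.nil), ?_⟩
  simp only [load, exec_comp, exec_pair, exec_bits, exec_nil, PMF.pure_bind, exec_mapIdx,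
    Data.toList_ofList, key]
  rfl

theorem exec_circuit (x : Data) (ψ : QState) :
    circuit.exec x ψ = PMF.pure (.nil, ψ.applyCircuit x.toCircuit) := by
  have e : ∀ a s ψ, (comp .gate .fst).exec (Data.cons a s) ψ =
      PMF.pure (.nil, ψ.applyGate a.toGate) := by simp
  have key : ∀ (x : Data) (ψ : QState),
      denLoop (fun a _ ψ => PMF.pure (.nil, ψ.applyGate a.toGate)) x .nil ψ =
        PMF.pure (.nil, ψ.applyCircuit x.toCircuit) := by
    intro x
    induction x with
    | nil => intro ψ; rfl
    | cons a b _ ih =>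
      intro ψ
      rw [denLoop, PMF.pure_bind, ih]
      rfl
  simp [circuit, exec_fold _ _ e, key]

/-- Measure the output wire at the current position, and add the outcome to the bit of the context
at this position. -/
def readOut : Code :=
  xor (comp .fst (comp .meas (pair (pair (pair .nil (pair .nil .nil))
    (pair (comp .snd (comp .fst .snd)) (comp .snd .snd))) .nil))) (lookup ctx)

theorem PolyTime.readOut : readOut.PolyTime :=
  .xor (.comp .fst (.comp .meas (.pair (.pair (.pair .nil (.pair .nil .nil))
    (.pair (.comp .snd (.comp .fst .snd)) (.comp .snd .snd))) .nil))) (.lookup .ctx)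

theorem exec_readOut {n l : ℕ} (a : Data) (m : Fin n → Fin l → Bool) (i : Fin n) (j : Fin l)
    (ψ : QState) :
    readOut.exec (gridEnv a (Data.grid fun i j => Data.ofBit (m i j)) i j) ψ =
      (ψ.measure {Wire.out i j}).bind fun r =>
        PMF.pure (Data.ofBit (decide (Wire.out i j ∈ r.1) ^^ m i j), r.2) := by
  -- The tag is a list of length two, the code of an output wire.
  have hw : Data.toWire (.cons (.cons .nil (.cons .nil .nil)) (.cons (.unary i) (.unary j))) =
      Wire.out i j := by
    simp [Data.toWire, Data.len]
  rw [readOut, exec_xor (b := m i j) (by simp)]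
  simp [Data.toList, hw, Data.ofList]

/-- Maps `(ct, (U, (s, m)))` to the sum of the bits `m` and of the output of the circuit `U` on the
ciphertexts `ct`. The shape of the output is given by the list of lists `s`. -/
def attack : Code :=
  comp (mapGrid readOut) (comp (comp .snd .snd)
    (pair (comp load .fst) (pair (comp circuit (comp .fst .snd)) (comp .snd .snd))))

theorem PolyTime.attack : attack.PolyTime :=
  .comp (.mapGrid .readOut) (.comp (.comp .snd .snd)
    (.pair (.comp .load .fst) (.pair (.comp .circuit (.comp .fst .snd)) (.comp .snd .snd))))

/-- The program measures the output wires one by one, `runCircuit` all at once. Both give the output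
bits of one basis state drawn by Born's rule; nothing is claimed about the final memory. -/
theorem exec_attack {n l : ℕ} (ct : Fin n → Data) (U : Data) (s : Fin n → Fin l → Data)
    (m : Fin n → Fin l → Bool) (ψ : QState) :
    ((attack.exec (.cons (.ofFn ct) (.cons U (.cons (.grid s)
      (.grid fun i j => .ofBit (m i j))))) ψ).bind fun r => PMF.pure r.1) =
      (runCircuit l U ψ ct).bind fun m' =>
        PMF.pure (.grid fun i j => .ofBit (m' i j ^^ m i j)) := by
  obtain ⟨y, hy⟩ := exec_load (Data.ofFn ct) ψ
  have e : (fun i : Fin n => seqFin l fun j : Fin l => readOut.exec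
      (gridEnv (s i j) (Data.grid fun i j => Data.ofBit (m i j)) i j)) = fun i : Fin n =>
      seqFin l fun (j : Fin l) ψ => (ψ.measure {Wire.out i j}).bind fun r =>
        PMF.pure (Data.ofBit (decide (Wire.out i j ∈ r.1) ^^ m i j), r.2) := by
    funext i
    congr 1
    funext j ψ
    exact exec_readOut ..
  simp only [attack, exec_comp, exec_pair, exec_fst, exec_snd, PMF.pure_bind, Data.fst_cons,
    Data.snd_cons, hy, exec_circuit, exec_mapGrid, e, PMF.bind_bind, runCircuit]
  set φ := (ψ.load (Data.ofFn ct).bits).applyCircuit U.toCircuit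
  -- Both kinds of reading are reduced to `φ.born`: `h2` for the single wires, `h3` for the joint
  -- measurement.
  have h1 := QState.Reads.seqFin fun i : Fin n => QState.Reads.seqFin fun j : Fin l =>
    (QState.reads_measure {Wire.out i j}).bind_pure fun o =>
      Data.ofBit (decide (Wire.out i j ∈ o) ^^ m i j)
  have h2 := congrArg (fun p => p.bind fun r => PMF.pure (Data.grid r)) (h1.fst φ)
  have h3 := congrArg (fun p => p.bind fun r => PMF.pure (Data.grid fun (i : Fin n) (j : Fin l) =>
    .ofBit (decide (Wire.out i j ∈ r) ^^ m i j))) ((QState.reads_measure (outWires n l)).fst φ)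
  simp only [PMF.bind_bind, PMF.pure_bind] at h2 h3 ⊢
  rw [h2, h3]
  congr! 5 with s i j
  simp [outWires]

end Code

/-! ## The extractor -/

namespace PMF

theorem bind_fst {α β γ : Type*} (p : PMF (α × β)) (f : α → PMF γ) :
    (p.bind fun r => f r.1) = (p.bind fun r => PMF.pure r.1).bind f := by
  simp only [PMF.bind_bind, PMF.pure_bind]

end PMF

theorem indep_indep_uniform (n l : ℕ) :
    (indep n fun _ => indep l fun _ => PMF.uniformOfFintype Bool) =
      PMF.uniformOfFintype (Fin n → Fin l → Bool) := by
  simp only [indep_uniformOfFintype]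

/-- The ciphertexts of the instances, as lists of pairs. -/
def ctRows {n l : ℕ} (c : Fin n → Fin l → Bool → Data) (i : Fin n) : Data :=
  Data.ofFn fun j => Data.cons (c i j false) (c i j true)

namespace Code

/-- Run a program and put its output in front of the input of the next one. -/
def letIn (c d : Code) : Code := comp d (pair c .id)

theorem PolyTime.letIn {c d : Code} (hc : c.PolyTime) (hd : d.PolyTime) : (letIn c d).PolyTime :=
  .comp hd (.pair hc .id)

@[simp] theorem exec_letIn (c d : Code) (x : Data) (ψ : QState) :
    (letIn c d).exec x ψ = (c.exec x ψ).bind fun r => d.exec (.cons r.1 x) r.2 := by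
  simp [letIn]

theorem exec_mapGrid_coin {n l : ℕ} (f : Fin n → Fin l → Data) (x : Data) (ψ : QState) :
    (mapGrid .coin).exec (.cons (.grid f) x) ψ =
      (PMF.uniformOfFintype (Fin n → Fin l → Bool)).bind fun m =>
        PMF.pure (.grid fun i j => .ofBit (m i j), ψ) := by
  rw [exec_mapGrid_eq_indep (D := fun _ _ => PMF.uniformOfFintype Bool)
    (h := fun _ _ => Data.ofBit) (fun i j ψ => exec_coin _ ψ), indep_indep_uniform]

theorem exec_attack_bind {n l : ℕ} {β : Type} (ct : Fin n → Data) (U : Data)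
    (s : Fin n → Fin l → Data) (m : Fin n → Fin l → Bool) (ψ : QState) (G : Data → PMF β) :
    ((attack.exec (.cons (.ofFn ct) (.cons U (.cons (.grid s)
      (.grid fun i j => .ofBit (m i j))))) ψ).bind fun r => G r.1) =
      (runCircuit l U ψ ct).bind fun m' => G (.grid fun i j => .ofBit (m' i j ^^ m i j)) := by
  rw [PMF.bind_fst, exec_attack]
  simp only [PMF.bind_bind, PMF.pure_bind]

end Code

namespace PKE

open Code

variable (P : PKE)

theorem exec_kg (x : Data) (ψ : QState) :
    P.kg.exec x ψ = (P.kg.sample x).bind fun a => PMF.pure (a, ψ) := P.kg_ppt.1.exec_eq x ψ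

theorem exec_enc (ek : Data) (m : Bool) (ψ : QState) :
    P.enc.exec (.cons ek (.ofBit m)) ψ =
      (P.encrypt ek m).bind fun a => PMF.pure (a, ψ) := P.enc_ppt.1.exec_eq _ ψ

/-- Encrypt a bit of the context under the first key and its negation under the second key. -/
def encOpposite : Code :=
  pair (comp P.enc (pair (comp .fst .fst) (lookup ctx)))
    (comp P.enc (pair (comp .snd .fst) (not (lookup ctx))))

/-- The mark extractor: on `(1^lam, (ek, U))`, encrypt opposite random bits under the two keys of
each pair, run the adversary once, and add its output to the random bits. -/
def extractor : Code :=
  letIn (comp (mapGrid .coin) (pair (comp .fst .snd) .nil))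
    (comp attack (pair
      (comp (mapGrid P.encOpposite) (pair (comp .fst (comp .snd .snd)) .fst))
      (pair (comp .snd (comp .snd .snd)) (pair (comp .fst (comp .snd .snd)) .fst))))

theorem polyTime_extractor : P.extractor.PolyTime := by
  have h1 := P.enc_ppt.2
  unfold extractor encOpposite
  repeat' with_reducible first
    | exact h1 | exact .id | exact .nil | exact .fst | exact .snd | exact .coin | exact .attack
    | exact .ctx | apply PolyTime.letIn | apply PolyTime.mapGrid | apply PolyTime.not
    | apply PolyTime.lookup | apply PolyTime.pair | apply PolyTime.comp

theorem exec_encOpposite {n l : ℕ} (ek : Bool → Data) (m : Fin n → Fin l → Bool) (i : Fin n)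
    (j : Fin l) (ψ : QState) :
    P.encOpposite.exec (gridEnv (.cons (ek false) (ek true))
      (.grid fun i j => .ofBit (m i j)) i j) ψ =
      (P.encrypt (ek false) (m i j ^^ false)).bind fun a =>
        (P.encrypt (ek true) (m i j ^^ true)).bind fun b => PMF.pure (.cons a b, ψ) := by
  simp [encOpposite, exec_enc]

/-- The continuation `G` sees the output only, because `exec_attack` determines only the
distribution of the output. -/
theorem exec_extractor {n l : ℕ} {β : Type} (ek : Fin n → Fin l → Bool → Data) (U x : Data)
    (ψ : QState) (G : Data → PMF β) :
    ((P.extractor.exec (.cons x (.cons (.grid fun i j => .cons (ek i j false) (ek i j true)) U))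
        ψ).bind fun r => G r.1) =
      (PMF.uniformOfFintype (Fin n → Fin l → Bool)).bind fun m =>
      (indepGrid n l fun i j b => P.encrypt (ek i j b) (m i j ^^ b)).bind fun c =>
      (runCircuit l U ψ (ctRows c)).bind fun m' =>
        G (.grid fun i j => .ofBit (m' i j ^^ m i j)) := by
  have h : ∀ (m : Fin n → Fin l → Bool) ψ, _ := fun m ψ =>
    exec_mapGrid_eq_indepGrid (g := P.encOpposite) (ctx := .grid fun i j => .ofBit (m i j))
      (D := fun i j b => P.encrypt (ek i j b) (m i j ^^ b))
      (h := fun _ _ a b => .cons a b) (fun i j ψ => P.exec_encOpposite (ek i j) m i j ψ) ψ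
  simp only [extractor, exec_letIn, exec_comp, exec_pair, exec_fst, exec_snd, exec_nil,
    PMF.pure_bind, Data.fst_cons, Data.snd_cons, PMF.bind_bind, exec_mapGrid_coin, h]
  congr! 4 with m c
  exact exec_attack_bind (ctRows c) U _ m ψ G

end PKE

/-! ## Hybrid experiments -/

section Hybrids

variable (P : PKE) (A : ParAdversary) (lam : ℕ) {n l : ℕ}

/-- The key pairs of all instances. -/
noncomputable def rawKeys (n l : ℕ) : PMF (Fin n → Fin l → Bool → Data) :=
  indepGrid n l fun _ _ _ => P.kg.sample (Data.unary lam)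

/-- The public keys of the instances, as lists of pairs. -/
def ekRows (K : Fin n → Fin l → Bool → Data) (i : Fin n) : Data :=
  Data.ofFn fun j => Data.cons (K i j false).fst (K i j true).fst

/-- The marked keys of the instances. -/
def markRows (K : Fin n → Fin l → Bool → Data) (x : Fin n → Fin l → Bool) (i : Fin n) : Data :=
  Data.cons (Data.ofFn fun j => Data.ofBit (x i j)) (Data.ofFn fun j => (K i j (x i j)).snd)

/-- The marks in an output of the first stage of the adversary. -/
def chosenMarks (n l : ℕ) (r : Data) (i : Fin n) (j : Fin l) : Bool :=
  ((r.fst.nth i).nth j).toBit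

/-- The first stage of the adversary. -/
noncomputable def chooseStage (K : Fin n → Fin l → Bool → Data) : PMF (Data × QState) :=
  A.choose.exec (Data.cons (Data.unary lam) (Data.cons (A.advice.classical lam)
    (Data.ofFn (ekRows K)))) (A.advice.quantum lam)

/-- The second stage of the adversary. -/
noncomputable def prepareStage (K : Fin n → Fin l → Bool → Data) (r : Data × QState) :
    PMF (Data × QState) :=
  A.prepare.exec (Data.cons r.1.snd (Data.ofFn (markRows K (chosenMarks n l r.1)))) r.2

/-- Inversion of ciphertexts in which, at the positions in `S`, the component that does not belong
to the mark is an encryption of the opposite bit. -/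
noncomputable def challengeStage (K : Fin n → Fin l → Bool → Data) (x : Fin n → Fin l → Bool)
    (S : Fin n → Fin l → Bool → Bool) (u : Data × QState) : PMF Bool :=
  (PMF.uniformOfFintype (Fin n → Fin l → Bool)).bind fun m =>
  (indepGrid n l fun i j b =>
    P.encrypt (K i j b).fst (m i j ^^ (S i j b && (b != x i j)))).bind fun c =>
  (runCircuit l u.1 u.2 (ctRows c)).bind fun m' => PMF.pure (decide (m' = m))

/-- The hybrid experiment with fixed keys. -/
noncomputable def hybridWith (K : Fin n → Fin l → Bool → Data)
    (S : Fin n → Fin l → Bool → Bool) : PMF Bool :=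
  (chooseStage A lam K).bind fun r => (prepareStage A K r).bind fun u =>
    challengeStage P K (chosenMarks n l r.1) S u

/-- The hybrid experiment. -/
noncomputable def hybrid (S : Fin n → Fin l → Bool → Bool) : PMF Bool :=
  (rawKeys P lam n l).bind fun K => hybridWith P A lam K S

/-- The keys are regrouped as functions of the bit `b`, so that all instances together form one
`indepGrid`, in which a single position can be isolated. -/
theorem wpkeOf_kg (ℓ : ℕ → ℕ) :
    (wpkeOf P ℓ).kg lam = (indep (ℓ lam) fun _ => (P.kg.sample (Data.unary lam)).bind fun a =>
      (P.kg.sample (Data.unary lam)).bind fun b =>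
        PMF.pure fun c : Bool => if c then b else a).bind fun k =>
      PMF.pure (Data.ofFn fun j => Data.cons (k j false).fst (k j true).fst,
        Data.ofFn fun j => Data.cons (k j false).snd (k j true).snd) := by
  have h : ((P.keyGen lam).bind fun k0 => (P.keyGen lam).bind fun k1 => PMF.pure (k0, k1)) =
      ((P.kg.sample (Data.unary lam)).bind fun a => (P.kg.sample (Data.unary lam)).bind fun b =>
        PMF.pure fun c : Bool => if c then b else a).bind fun s =>
      PMF.pure (((s false).fst, (s false).snd), ((s true).fst, (s true).snd)) := by
    simp [PKE.keyGen]
  simp only [wpkeOf, h]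
  rw [indep_bind_pure _ fun _ (s : Bool → Data) =>
    (((s false).fst, (s false).snd), ((s true).fst, (s true).snd))]
  simp only [PMF.bind_bind, PMF.pure_bind]

theorem parSetup_wpkeOf (ℓ : ℕ → ℕ) (n : ℕ) :
    parSetup (wpkeOf P ℓ) A n lam = (rawKeys P lam n (ℓ lam)).bind fun K =>
      (chooseStage A lam K).bind fun r => (prepareStage A K r).bind fun u =>
        PMF.pure ⟨ekRows K, chosenMarks n (ℓ lam) r.1, u.1, u.2⟩ := by
  have hk : ∀ (k : Bool → Data) (b : Bool),
      (Data.cons (k false).snd (k true).snd).sel b = (k b).snd := by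
    intro k b; cases b <;> rfl
  unfold parSetup
  rw [wpkeOf_kg, indep_bind_pure _ fun _ (k : Fin (ℓ lam) → Bool → Data) =>
    (Data.ofFn fun j => Data.cons (k j false).fst (k j true).fst,
        Data.ofFn fun j => Data.cons (k j false).snd (k j true).snd)]
  simp only [PMF.bind_bind, PMF.pure_bind]
  simp only [wpkeOf, Data.nth_ofFn, hk]
  rfl

theorem indep_wpkeOf_enc (ℓ : ℕ → ℕ) (n : ℕ) (K : Fin n → Fin (ℓ lam) → Bool → Data)
    (m : Fin n → Fin (ℓ lam) → Bool) :
    (indep n fun i => (wpkeOf P ℓ).enc lam (ekRows K i) (m i)) =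
      (indepGrid n (ℓ lam) fun i j b => P.encrypt (K i j b).fst (m i j)).bind fun c =>
        PMF.pure (ctRows c) := by
  have h : ∀ p q : Fin (ℓ lam) → PMF Data, ((indep (ℓ lam) fun j =>
      (p j).bind fun a => (q j).bind fun b => PMF.pure (Data.cons a b)).bind fun c =>
        PMF.pure (Data.ofFn c)) =
      (indep (ℓ lam) fun j => (p j).bind fun a => (q j).bind fun b =>
        PMF.pure fun c : Bool => if c then b else a).bind fun s =>
        PMF.pure (Data.ofFn fun j => Data.cons (s j false) (s j true)) := by
    intro p q
    have := indep_bind_pure (n := ℓ lam) (fun j => (p j).bind fun a => (q j).bind fun b =>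
      PMF.pure fun c : Bool => if c then b else a)
      fun _ (s : Bool → Data) => Data.cons (s false) (s true)
    simp only [PMF.bind_bind, PMF.pure_bind, if_true, Bool.false_eq_true, if_false] at this
    simp only [this, PMF.bind_bind, PMF.pure_bind]
  simp only [wpkeOf, ekRows, Data.nth_ofFn, h]
  rw [indep_bind_pure _ fun _ (s : Fin (ℓ lam) → Bool → Data) =>
    Data.ofFn fun j => Data.cons (s j false) (s j true)]
  rfl

/-- With no position switched, the mark drops out of the ciphertexts; only the order and the
packaging of the samples differ. -/
theorem expParOW_eq_hybrid (ℓ : ℕ → ℕ) (n : ℕ) :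
    expParOW (wpkeOf P ℓ) A n lam =
      hybrid P A lam (n := n) (l := ℓ lam) fun _ _ _ => false := by
  unfold expParOW hybrid hybridWith challengeStage
  rw [parSetup_wpkeOf]
  simp only [PMF.bind_bind, PMF.pure_bind, Bool.false_and, Bool.xor_false]
  congr! 6 with K r u
  rw [indep_uniformOfFintype]
  refine congrArg _ (funext fun m : Fin n → Fin (ℓ lam) → Bool => ?_)
  refine (congrArg (fun p => p.bind fun ct => (runCircuit (ℓ lam) u.1 u.2 ct).bind fun m' =>
    PMF.pure (decide (m' = m))) (indep_wpkeOf_enc P lam ℓ n K m)).trans ?_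
  simp only [PMF.bind_bind, PMF.pure_bind]

/-- The marks are fixed before the extractor draws its bits, so adding them to $m$ keeps it uniform.
Component $b$ then holds $m\oplus x\oplus b$, that is, $m$ if $b=x$ and its negation otherwise. -/
theorem expParExt_eq_hybrid (ℓ : ℕ → ℕ) (n : ℕ) :
    expParExt (wpkeOf P ℓ) A P.extractor n lam =
      hybrid P A lam (n := n) (l := ℓ lam) fun _ _ _ => true := by
  unfold expParExt hybrid hybridWith challengeStage
  rw [parSetup_wpkeOf]
  simp only [PMF.bind_bind, PMF.pure_bind, Bool.true_and]
  refine congrArg _ (funext fun K => congrArg _ (funext fun r => congrArg _ (funext fun u => ?_)))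
  set x := chosenMarks n (ℓ lam) r.1
  refine (P.exec_extractor (fun i j b => (K i j b).fst) u.1 (.unary lam) u.2 fun y => PMF.pure
    (decide ((fun (i : Fin n) (j : Fin (ℓ lam)) => ((y.nth i).nth j).toBit) = x))).trans ?_
  set e : Equiv.Perm (Fin n → Fin (ℓ lam) → Bool) := Function.Involutive.toPerm
    (fun m i j => m i j ^^ x i j) fun m => by simp
  have he : ∀ m i j, e m i j = (m i j ^^ x i j) := fun _ _ _ => rfl
  rw [← PMF.uniformOfFintype_bind_equiv e]
  refine congrArg _ (funext fun m => ?_)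
  -- `hb` translates the plaintexts, and `hc` turns "the extracted bit is the mark" into "the
  -- adversary's bit is the message".
  have hb : ∀ a b c : Bool, (a ^^ c ^^ b) = (a ^^ (b != c)) := by decide
  have hc : ∀ a b c : Bool, (a ^^ (b ^^ c)) = c ↔ a = b := by decide
  simp only [he, hb, Data.nth_nth_grid, Data.toBit_ofBit, funext_iff, hc]

end Hybrids

/-! ## The reduction to IND-CPA security -/

section Reduction

variable (P : PKE) (A : ParAdversary) (lam : ℕ) {n l : ℕ}

/-- The flags of a position: whether it is the challenge position `p`, and whether it is in `S`. -/
def flags (S : Fin n → Fin l → Bool → Bool) (p : Fin n × Fin l × Bool) (i : Fin n) (j : Fin l) :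
    Data :=
  Data.cons (Data.cons (Data.ofBit (decide ((i, j, false) = p))) (Data.ofBit (S i j false)))
    (Data.cons (Data.ofBit (decide ((i, j, true) = p))) (Data.ofBit (S i j true)))

/-- The description of a position. -/
def posData (p : Fin n × Fin l × Bool) : Data :=
  Data.cons (Data.unary p.1) (Data.cons (Data.unary p.2.1) (Data.ofBit p.2.2))

/-! ### Programs of the reduction -/

namespace PKE

open Code

/-- Sample a key pair, except at the challenge position. -/
def keyEntry (s : Code) : Code :=
  ite (comp .fst (comp s .fst)) (pair (comp .snd ctx) .nil) (comp P.kg (comp .fst ctx))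

/-- Sample the key pairs of an entry. -/
def keyPair : Code := pair (P.keyEntry .fst) (P.keyEntry .snd)

theorem exec_keyPair (f : Bool → Bool) (y₀ y₁ x e : Data) (i j : ℕ) (ψ : QState) :
    P.keyPair.exec (gridEnv (.cons (.cons (.ofBit (f false)) y₀) (.cons (.ofBit (f true)) y₁))
      (.cons x e) i j) ψ =
      (if f false = true then PMF.pure (.cons e .nil) else P.kg.sample x).bind fun a =>
        (if f true = true then PMF.pure (.cons e .nil) else P.kg.sample x).bind fun b =>
          PMF.pure (.cons a b, ψ) := by
  cases f false <;> cases f true <;> simp [keyPair, keyEntry, exec_kg]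

/-- Encrypt the bit of the hybrid experiment, except at the challenge position. The bit `d` tells
whether the key does not belong to the mark. -/
def ctEntry (s d : Code) : Code :=
  ite (comp .fst (comp s .fst)) (comp .fst ctx)
    (comp P.enc (pair (comp .fst (comp s (lookup (comp (comp .fst .snd) ctx))))
      (ite (comp .snd (comp s .fst))
        (xor d (lookup (comp (comp .snd (comp .snd .snd)) ctx)))
        (lookup (comp (comp .snd (comp .snd .snd)) ctx)))))

/-- The ciphertexts of an entry. -/
def ctPair : Code :=
  pair (P.ctEntry .fst (lookup (comp (comp .fst (comp .snd .snd)) ctx)))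
    (P.ctEntry .snd (not (lookup (comp (comp .fst (comp .snd .snd)) ctx))))

theorem exec_ctPair (f s : Bool → Bool) (k : Bool → Data) (m : Bool) (ct K X M : Data) (i j : ℕ)
    (hK : (K.nth i).nth j = .cons (k false) (k true)) (hM : (M.nth i).nth j = .ofBit m)
    (ψ : QState) :
    P.ctPair.exec (gridEnv (.cons (.cons (.ofBit (f false)) (.ofBit (s false)))
      (.cons (.ofBit (f true)) (.ofBit (s true)))) (.cons ct (.cons K (.cons X M))) i j) ψ =
      (if f false = true then PMF.pure ct else P.encrypt (k false).fst
        (m ^^ (s false && (false != ((X.nth i).nth j).toBit)))).bind fun a =>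
      (if f true = true then PMF.pure ct else P.encrypt (k true).fst
        (m ^^ (s true && (true != ((X.nth i).nth j).toBit)))).bind fun b =>
          PMF.pure (.cons a b, ψ) := by
  cases f false <;> cases f true <;> cases s false <;> cases s true <;>
    cases hx : ((X.nth i).nth j).toBit <;>
    simp [ctPair, ctEntry, Code.xor, exec_enc, hK, hM, hx]

/-- Remove the secret keys of an entry. -/
def _root_.Code.ekPair : Code := pair (comp .fst (comp .fst .fst)) (comp .fst (comp .snd .fst))

/-- The marked key of an instance. -/
def _root_.Code.markRow : Code :=
  -- The double negation normalizes the bit: the adversary may have written any nonempty tree for 1,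
  -- whereas a marked key contains `ofBit`. The instance loop supplies `(row, (x, 1^i))`, so the
  -- inner loop produces an environment in which `lookup` works.
  pair (mapIdx (not (not (lookup ctx))))
    (mapIdx (ite (lookup ctx) (comp .snd (comp .snd .fst)) (comp .snd (comp .fst .fst))))

end PKE

/-- The list of the pairs of key pairs. -/
def keyGrid (K : Fin n → Fin l → Bool → Data) : Data :=
  Data.grid fun i j => Data.cons (K i j false) (K i j true)

namespace Code

theorem exec_mapGrid_ekPair (K : Fin n → Fin l → Bool → Data) (x : Data) (ψ : QState) :
    (mapGrid ekPair).exec (.cons (keyGrid K) x) ψ = PMF.pure (.ofFn (ekRows K), ψ) :=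
  exec_mapGrid_eq_pure (fun i j ψ => by simp [ekPair]) ψ

theorem exec_mapIdx_markRow (K : Fin n → Fin l → Bool → Data) (x : Data) (ψ : QState) :
    (mapIdx markRow).exec (.cons (keyGrid K) x) ψ =
      PMF.pure (.ofFn (markRows K fun i j => ((x.nth i).nth j).toBit), ψ) := by
  refine exec_mapIdx_eq_pure (fun i ψ => ?_) ψ
  have h1 := exec_mapIdx_eq_pure (g := not (not (lookup ctx)))
    (f := fun j : Fin l => .cons (K i j false) (K i j true)) (ctx := .cons x (.unary i))
    (h := fun j => .ofBit ((x.nth i).nth j).toBit) (fun j ψ => by simp)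
  have h2 := exec_mapIdx_eq_pure
    (g := ite (lookup ctx) (comp .snd (comp .snd .fst)) (comp .snd (comp .fst .fst)))
    (f := fun j : Fin l => .cons (K i j false) (K i j true)) (ctx := .cons x (.unary i))
    (h := fun j => (K i j ((x.nth i).nth j).toBit).snd) (fun j ψ => by
      simp only [exec_ite, exec_lookup, exec_ctx, PMF.pure_bind]
      cases ((x.nth i).nth j).toBit <;> simp)
  simp only [markRow, exec_pair, h1, h2, PMF.pure_bind, markRows]

/-- Do all bits of a list of lists vanish? -/
def allZero : Code := not (comp any (comp (mapIdx (comp any .fst)) (pair .id .nil)))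

theorem PolyTime.allZero : allZero.PolyTime :=
  .not (.comp .any (.comp (.mapIdx (.comp .any .fst)) (.pair .id .nil)))

theorem classical_allZero : allZero.Classical := by
  simp [allZero, Classical, not, any, mapIdx, rev]

theorem exec_allZero (f : Fin n → Fin l → Bool) (ψ : QState) :
    allZero.exec (.grid fun i j => .ofBit (f i j)) ψ =
      PMF.pure (.ofBit (decide (∀ i j, f i j = false)), ψ) := by
  have hrow : ∀ ψ, (mapIdx (comp any .fst)).exec (.cons (.grid fun i j => .ofBit (f i j)) .nil) ψ =
      PMF.pure (.ofFn fun i => .ofBit (decide (∃ j, f i j = true)), ψ) :=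
    exec_mapIdx_eq_pure fun i ψ => by simp [exec_any]
  simp only [allZero, exec_not, exec_comp, exec_pair, exec_id, exec_nil, PMF.pure_bind, hrow,
    exec_any, Data.toBit_ofBit, decide_eq_true_eq, ← decide_not, not_exists, Bool.not_eq_true]

end Code

namespace PKE

open Code

/-- First stage of the reduction. The input is `(1^lam, ((a, (T, p)), ek))`, with the advice `a` of
the adversary, the flags `T` and the challenge position `p`. -/
def redChoose : Code :=
  letIn (comp (mapGrid P.keyPair)
    (pair (comp .fst (comp .snd (comp .fst .snd))) (pair .fst (comp .snd .snd)))) <|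
  letIn (comp A.choose (pair (comp .fst .snd) (pair (comp .fst (comp .fst (comp .snd .snd)))
    (comp (mapGrid ekPair) (pair .fst .nil))))) <|
  letIn (comp A.prepare (pair (comp .snd .fst)
    (comp (mapIdx markRow) (pair (comp .fst .snd) (comp .fst .fst))))) <|
  letIn (comp (mapGrid .coin)
    (pair (comp (comp .fst (comp .snd (comp .fst .snd))) (comp .snd (comp .snd .snd))) .nil)) <|
  letIn (comp (comp .snd (comp .snd (comp .fst .snd))) (comp .snd (comp .snd (comp .snd .snd)))) <|
  letIn (comp nth (pair (comp .fst (comp .snd .fst))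
    (comp nth (pair (comp .fst .fst) (comp .fst .snd))))) <|
  letIn (comp nth (pair (comp .fst (comp .snd (comp .fst .snd)))
    (comp nth (pair (comp .fst (comp .fst .snd))
      (comp .fst (comp .fst (comp .snd (comp .snd (comp .snd .snd))))))))) <|
  -- The environment is now `(x_p, (m_p, (p, (m, (U, (r, (K, input)))))))`. The challenge messages
  -- are `m_p` and `m_p` plus the bit that tells whether `p` is off the mark; the state passed on is
  -- `(T, (K, (x, (m, U))))`.
  pair (pair (comp .fst .snd)
      (xor (xor .fst (comp .snd (comp .snd (comp .fst (comp .snd .snd))))) (comp .fst .snd)))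
    (comp (pair (comp (comp .fst (comp .snd (comp .fst .snd)))
        (comp .snd (comp .snd (comp .snd .snd))))
      (pair (comp .fst (comp .snd (comp .snd .snd)))
        (pair (comp .fst (comp .fst (comp .snd .snd))) (pair .fst (comp .fst .snd)))))
      (comp .snd (comp .snd .snd)))

/-- Second stage of the reduction. The input is `((T, (K, (x, (m, U)))), ct)`. -/
def redGuess : Code :=
  comp allZero (comp attack
    (pair (comp (mapGrid P.ctPair) (pair (comp .fst .fst) (pair .snd
      (pair (comp .fst (comp .snd .fst)) (pair (comp .fst (comp .snd (comp .snd .fst)))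
        (comp .fst (comp .snd (comp .snd (comp .snd .fst)))))))))
      (pair (comp .snd (comp .snd (comp .snd (comp .snd .fst))))
        (pair (comp .fst .fst) (comp .fst (comp .snd (comp .snd (comp .snd .fst))))))))

theorem polyTime_redChoose : (P.redChoose A).PolyTime := by
  have h1 := P.kg_ppt.2
  have h2 := A.choose_poly
  have h3 := A.prepare_poly
  unfold redChoose keyPair keyEntry ekPair markRow
  repeat' with_reducible first
    | exact h1 | exact h2 | exact h3 | exact .id | exact .nil | exact .fst | exact .snd
    | exact .coin | exact .nth | exact .ctx | apply PolyTime.letIn | apply PolyTime.mapGrid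
    | apply PolyTime.mapIdx | apply PolyTime.not | apply PolyTime.xor | apply PolyTime.lookup
    | apply PolyTime.pair | apply PolyTime.comp | apply PolyTime.ite

theorem polyTime_redGuess : P.redGuess.PolyTime := by
  have h1 := P.enc_ppt.2
  unfold redGuess ctPair ctEntry
  repeat' with_reducible first
    | exact h1 | exact .id | exact .nil | exact .fst | exact .snd | exact .allZero | exact .attack
    | exact .ctx | apply PolyTime.mapGrid | apply PolyTime.mapIdx | apply PolyTime.not
    | apply PolyTime.xor | apply PolyTime.lookup | apply PolyTime.pair | apply PolyTime.comp
    | apply PolyTime.ite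

theorem exec_mapGrid_keyPair (S : Fin n → Fin l → Bool → Bool) (p : Fin n × Fin l × Bool)
    (x e : Data) (ψ : QState) :
    (mapGrid P.keyPair).exec (.cons (.grid (flags S p)) (.cons x e)) ψ =
      (indepGrid n l fun i j b => if (i, j, b) = p then PMF.pure (.cons e .nil)
        else P.kg.sample x).bind fun K => PMF.pure (keyGrid K, ψ) := by
  refine exec_mapGrid_eq_indepGrid (h := fun _ _ a b => .cons a b) (fun i j ψ => ?_) ψ
  rw [flags, P.exec_keyPair fun b => decide ((i, j, b) = p)]
  simp only [decide_eq_true_eq]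

theorem exec_mapGrid_ctPair (S : Fin n → Fin l → Bool → Bool) (p : Fin n × Fin l × Bool)
    (K : Fin n → Fin l → Bool → Data) (m : Fin n → Fin l → Bool) (ct X : Data) (ψ : QState) :
    (mapGrid P.ctPair).exec (.cons (.grid (flags S p)) (.cons ct (.cons (keyGrid K)
      (.cons X (.grid fun i j => .ofBit (m i j)))))) ψ =
      (indepGrid n l fun i j b => if (i, j, b) = p then PMF.pure ct else
        P.encrypt (K i j b).fst (m i j ^^ (S i j b && (b != ((X.nth i).nth j).toBit)))).bind
          fun c => PMF.pure (.ofFn (ctRows c), ψ) := by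
  refine exec_mapGrid_eq_indepGrid (h := fun _ _ a b => .cons a b) (fun i j ψ => ?_) ψ
  rw [flags, P.exec_ctPair (fun b => decide ((i, j, b) = p)) (S i j) (K i j) (m i j)]
  · simp only [decide_eq_true_eq]
  · simp [keyGrid]
  · simp

theorem exec_redChoose (S : Fin n → Fin l → Bool → Bool) (p : Fin n × Fin l × Bool)
    (e : Data) :
    (P.redChoose A).exec (.cons (.unary lam) (.cons (.cons (A.advice.classical lam)
      (.cons (.grid (flags S p)) (posData p))) e)) (A.advice.quantum lam) =
      (indepGrid n l fun i j b => if (i, j, b) = p then PMF.pure (.cons e .nil)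
        else P.kg.sample (.unary lam)).bind fun K =>
      (chooseStage A lam K).bind fun r => (prepareStage A K r).bind fun u =>
      (PMF.uniformOfFintype (Fin n → Fin l → Bool)).bind fun m =>
      PMF.pure (.cons (.cons (.ofBit (m p.1 p.2.1))
          (.ofBit (m p.1 p.2.1 ^^ (p.2.2 != chosenMarks n l r.1 p.1 p.2.1))))
        (.cons (.grid (flags S p)) (.cons (keyGrid K) (.cons r.1.fst
          (.cons (.grid fun i j => .ofBit (m i j)) u.1)))), u.2) := by
  have hx : ∀ a b c : Bool, (a ^^ b ^^ c) = (c ^^ (b != a)) := by decide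
  have hxor : ∀ (c d : Code) (y : Data) ψ, (Code.xor c d).exec y ψ = (c.exec y ψ).bind fun r =>
      (d.exec y r.2).bind fun s =>
        PMF.pure (if r.1.toBit then .ofBit (!s.1.toBit) else s.1, s.2) := by
    intro c d y ψ
    simp only [Code.xor, exec_ite, exec_not]
    congr! 2 with r
    cases r.1.toBit <;> simp
  have hbit : ∀ a b : Bool, (if a = true then Data.ofBit (!b) else .ofBit b) =
      .ofBit (a ^^ b) := by decide
  simp only [redChoose, exec_letIn, exec_comp, exec_pair, exec_fst, exec_snd, exec_nil,
    PMF.pure_bind, Data.fst_cons, Data.snd_cons, PMF.bind_bind, exec_mapGrid_keyPair,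
    exec_mapGrid_ekPair, exec_mapIdx_markRow, exec_mapGrid_coin, posData, exec_nth, hxor,
    Data.nth_nth_grid, Data.toBit_ofBit, hbit, hx, chooseStage, prepareStage, chosenMarks]
  rfl

theorem exec_redGuess (S : Fin n → Fin l → Bool → Bool) (p : Fin n × Fin l × Bool)
    (K : Fin n → Fin l → Bool → Data) (m : Fin n → Fin l → Bool) (ct X U : Data) (ψ : QState) :
    ((P.redGuess.exec (.cons (.cons (.grid (flags S p)) (.cons (keyGrid K) (.cons X
      (.cons (.grid fun i j => .ofBit (m i j)) U)))) ct) ψ).bind fun g =>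
        PMF.pure g.1.toBit) =
      (indepGrid n l fun i j b => if (i, j, b) = p then PMF.pure ct else
        P.encrypt (K i j b).fst (m i j ^^ (S i j b && (b != ((X.nth i).nth j).toBit)))).bind
      fun c => (runCircuit l U ψ (ctRows c)).bind fun m' => PMF.pure (decide (m' = m)) := by
  -- The final test is classical, so its verdict depends only on the output of `attack` and not on
  -- the memory left behind, as `exec_attack_bind` requires.
  have hz : ∀ (y : Data) φ, ((allZero.exec y φ).bind fun g => PMF.pure g.1.toBit) =
      (allZero.sample y).bind fun g => PMF.pure g.toBit := by
    intro y φ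
    rw [classical_allZero.exec_eq]
    simp only [PMF.bind_bind, PMF.pure_bind]
  simp only [redGuess, exec_comp, exec_pair, exec_fst, exec_snd, PMF.pure_bind, Data.fst_cons,
    Data.snd_cons, PMF.bind_bind, exec_mapGrid_ctPair, hz]
  refine congrArg _ (funext fun c => ?_)
  rw [exec_attack_bind (ctRows c) U (flags S p) m ψ fun y =>
    (allZero.sample y).bind fun g => PMF.pure g.toBit]
  refine congrArg _ (funext fun m' => ?_)
  have hall : decide (∀ i j, (m' i j ^^ m i j) = false) = decide (m' = m) := by
    simp [funext_iff]
  simp only [sample, exec_allZero, PMF.pure_bind, Data.toBit_ofBit, hall]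

end PKE

/-- The non-uniform advice of the reduction. -/
def configData (c : Option ((Fin n → Fin l → Bool → Bool) × Fin n × Fin l × Bool)) : Data :=
  c.elim Data.nil fun c => Data.cons (Data.grid (flags c.1 c.2)) (posData c.2)

theorem size_configData_le (c : Option ((Fin n → Fin l → Bool → Bool) × Fin n × Fin l × Bool)) :
    (configData c).size ≤ n * (16 * l + 2) + 2 * n + 2 * l + 9 := by
  have hb := Data.size_ofBit_le
  cases c with
  | none => simp [configData, Data.size]
  | some c =>
    obtain ⟨S, p⟩ := c
    -- The flags of an entry have at most 15 nodes: four bits of at most three nodes each and three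
    -- pairings.
    have h1 : (Data.grid (flags S p)).size ≤ n * (l * (15 + 1) + 1 + 1) + 1 :=
      Data.size_ofFn_le _ _ fun i => Data.size_ofFn_le _ _ fun j => by
        have h1 := hb (decide ((i, j, false) = p))
        have h2 := hb (decide ((i, j, true) = p))
        have h3 := hb (S i j false)
        have h4 := hb (S i j true)
        simp only [flags, Data.size]
        omega
    have h2 := hb p.2.2
    have h3 := p.1.isLt
    have h4 := p.2.1.isLt
    have h5 : n * (l * (15 + 1) + 1 + 1) = n * (16 * l + 2) := by ring
    simp only [configData, Option.elim_some, Data.size, posData, Data.size_unary]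
    omega

/-- The adversary of the reduction. -/
noncomputable def reduction {n ℓ : ℕ → ℕ} (hn : PolyBounded n) (hℓ : PolyBounded ℓ)
    (c : ∀ lam, Option ((Fin (n lam) → Fin (ℓ lam) → Bool → Bool) ×
      Fin (n lam) × Fin (ℓ lam) × Bool)) : CPAAdversary where
  advice :=
    { classical := fun lam => Data.cons (A.advice.classical lam) (configData (c lam))
      quantum := A.advice.quantum
      bounded := by
        obtain ⟨p, hp⟩ := hn
        obtain ⟨q, hq⟩ := hℓ
        obtain ⟨a, ha⟩ := A.advice.bounded
        refine ⟨a + (p * (16 * q + 2) + 2 * p + 2 * q + 10), fun lam => ⟨?_, fun s hs w hw => ?_⟩⟩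
        · have h1 := (ha lam).1
          have h2 := size_configData_le (c lam)
          have h3 := hp lam
          have h4 := hq lam
          have h5 : n lam * (16 * ℓ lam + 2) ≤ p.eval lam * (16 * q.eval lam + 2) := by gcongr
          simp only [Data.size, Polynomial.eval_add, Polynomial.eval_mul, Polynomial.eval_ofNat]
          omega
        · obtain ⟨k, hk, rfl⟩ := (ha lam).2 s hs w hw
          exact ⟨k, hk.trans_le (by simp), rfl⟩ }
  choose := P.redChoose A
  guess := P.redGuess
  choose_poly := P.polyTime_redChoose A
  guess_poly := P.polyTime_redGuess

/-! ### The advantage of the reduction -/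

/-- Change the set of switched positions at the position `p`. -/
def setPos (S : Fin n → Fin l → Bool → Bool) (p : Fin n × Fin l × Bool) (v : Bool) (i : Fin n)
    (j : Fin l) (b : Bool) : Bool := if (i, j, b) = p then v else S i j b

/-- Erase the secret key at the position `p`. -/
def erasePos (p : Fin n × Fin l × Bool) (K : Fin n → Fin l → Bool → Data) (i : Fin n)
    (j : Fin l) (b : Bool) : Data :=
  if (i, j, b) = p then Data.cons (K i j b).fst Data.nil else K i j b

/-- The challenger's public key takes the one place where the reduction draws no key pair. As all
keys are independent, the result is a complete family of keys with one secret key erased. -/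
theorem rawKeys_erasePos (p : Fin n × Fin l × Bool) :
    ((P.kg.sample (Data.unary lam)).bind fun k => indepGrid n l fun i j b =>
      if (i, j, b) = p then PMF.pure (Data.cons k.fst Data.nil)
        else P.kg.sample (Data.unary lam)) =
      (rawKeys P lam n l).bind fun K => PMF.pure (erasePos p K) := by
  rw [bind_indepGrid_ite]
  refine Eq.trans ?_ (indepGrid_bind_pure (n := n) (l := l)
    (fun _ _ _ => P.kg.sample (Data.unary lam))
    fun i j b k => if (i, j, b) = p then Data.cons k.fst Data.nil else k)
  congr 1
  funext i j b
  split_ifs <;> simp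

/-- The challenge bit decides whether the position `p` is switched. The erased secret key is the
only deviation from the hybrid experiment. -/
theorem expCPA_reduction {n ℓ : ℕ → ℕ} (hn : PolyBounded n) (hℓ : PolyBounded ℓ)
    (c : ∀ lam, Option ((Fin (n lam) → Fin (ℓ lam) → Bool → Bool) ×
      Fin (n lam) × Fin (ℓ lam) × Bool))
    (S : Fin (n lam) → Fin (ℓ lam) → Bool → Bool) (p : Fin (n lam) × Fin (ℓ lam) × Bool)
    (hc : c lam = some (S, p)) (v : Bool) :
    expCPA P (reduction P A hn hℓ c) lam v = (rawKeys P lam (n lam) (ℓ lam)).bind fun K =>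
      hybridWith P A lam (erasePos p K) (setPos S p v) := by
  -- The challenge is encrypted under the challenger's `k`, the hybrid ciphertext under the entry of
  -- `K` at `p`; on the support the two keys coincide.
  have hstage : ∀ k K, K ∈ (indepGrid (n lam) (ℓ lam) fun i j b =>
      if (i, j, b) = p then PMF.pure (Data.cons k Data.nil)
        else P.kg.sample (Data.unary lam)).support → k = (K p.1 p.2.1 p.2.2).fst := by
    intro k K hK
    have := mem_support_of_indepGrid hK p.1 p.2.1 p.2.2
    rw [if_pos rfl, PMF.mem_support_pure_iff] at this
    rw [this, Data.fst_cons]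
  have hmsg : ∀ a b : Bool, (if v = true then a ^^ b else a) = (a ^^ (v && b)) := by
    cases v <;> simp
  have hbody : ∀ (k : Data) (K : Fin (n lam) → Fin (ℓ lam) → Bool → Data),
      k = (K p.1 p.2.1 p.2.2).fst → ((chooseStage A lam K).bind fun r =>
        (prepareStage A K r).bind fun u =>
        (PMF.uniformOfFintype (Fin (n lam) → Fin (ℓ lam) → Bool)).bind fun m =>
        (P.encrypt k (m p.1 p.2.1 ^^
          (v && (p.2.2 != chosenMarks (n lam) (ℓ lam) r.1 p.1 p.2.1)))).bind fun ct =>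
        (indepGrid (n lam) (ℓ lam) fun i j b => if (i, j, b) = p then PMF.pure ct else
          P.encrypt (K i j b).fst (m i j ^^ (S i j b &&
            (b != chosenMarks (n lam) (ℓ lam) r.1 i j)))).bind fun c =>
        (runCircuit (ℓ lam) u.1 u.2 (ctRows c)).bind fun m' => PMF.pure (decide (m' = m))) =
      hybridWith P A lam K (setPos S p v) := by
    rintro k K rfl
    unfold hybridWith challengeStage
    refine congrArg _ (funext fun r => congrArg _ (funext fun u => congrArg _ (funext fun m => ?_)))
    -- The challenge ciphertext, drawn ahead of the others, becomes the sample at `p`.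
    rw [← PMF.bind_bind, bind_indepGrid_ite]
    congr 2
    funext i j b
    simp only [PMF.bind_pure, setPos]
    split_ifs with h
    · subst h
      rfl
    · rfl
  have hstep : ∀ k, _ := fun k => P.exec_redChoose A lam S p k
  simp only [expCPA, PKE.keyGen, PMF.bind_bind, PMF.pure_bind, reduction, hc, configData,
    Option.elim_some, hstep, Data.fst_cons, Data.snd_cons, P.exec_redGuess, Data.toBit_ofBit,
    ← apply_ite, hmsg]
  refine Eq.trans (b := ((P.kg.sample (Data.unary lam)).bind fun k =>
    indepGrid (n lam) (ℓ lam) fun i j b => if (i, j, b) = p then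
      PMF.pure (Data.cons k.fst Data.nil) else P.kg.sample (Data.unary lam)).bind fun K =>
        hybridWith P A lam K (setPos S p v)) ?_ ?_
  · rw [PMF.bind_bind]
    exact congrArg _ (funext fun k => PMF.bind_congr_support _ fun K hK =>
      hbody k.fst K (hstage _ _ hK))
  · rw [rawKeys_erasePos, PMF.bind_bind]
    simp only [PMF.pure_bind]

theorem fst_erasePos (p : Fin n × Fin l × Bool) (K : Fin n → Fin l → Bool → Data) (i : Fin n)
    (j : Fin l) (b : Bool) : (erasePos p K i j b).fst = (K i j b).fst := by
  unfold erasePos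
  split_ifs <;> rfl

/-- The secret key at `p` does not matter for the effect of a switch at `p`. -/
theorem hybridWith_erasePos_add (S : Fin n → Fin l → Bool → Bool) (p : Fin n × Fin l × Bool)
    (K : Fin n → Fin l → Bool → Data) (t : Bool) :
    hybridWith P A lam (erasePos p K) (setPos S p false) t +
        hybridWith P A lam K (setPos S p true) t =
      hybridWith P A lam (erasePos p K) (setPos S p true) t +
        hybridWith P A lam K (setPos S p false) t := by
  have hek : ekRows (erasePos p K) = ekRows K := by
    funext i
    simp only [ekRows, fst_erasePos]
  have hch : ∀ x S u, challengeStage P (erasePos p K) x S u = challengeStage P K x S u := by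
    intro x S u
    simp only [challengeStage, fst_erasePos]
  simp only [hybridWith, chooseStage, hek, hch]
  refine PMF.bind_apply_add_bind_apply _ _ fun r => ?_
  -- The first stage sees public keys only, so its output `r` is common to all four terms. If `p`
  -- lies on the mark, the erased key may be handed out, but the switch changes no plaintext and the
  -- terms agree in pairs.
  by_cases hx : chosenMarks n l r.1 p.1 p.2.1 = p.2.2
  · have h : ∀ v u, challengeStage P K (chosenMarks n l r.1) (setPos S p v) u =
        challengeStage P K (chosenMarks n l r.1) (setPos S p false) u := by
      intro v u
      have : ∀ i j b, (setPos S p v i j b && (b != chosenMarks n l r.1 i j)) =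
          (setPos S p false i j b && (b != chosenMarks n l r.1 i j)) := by
        intro i j b
        unfold setPos
        split_ifs with h
        · subst h
          simp only at hx
          simp [hx]
        · rfl
      simp only [challengeStage, this]
    simp only [h true]
  -- If `p` lies off the mark, the erased key is not among the marked keys, so erasing it changes
  -- nothing.
  · have h : markRows (erasePos p K) (chosenMarks n l r.1) = markRows K (chosenMarks n l r.1) := by
      funext i
      have : ∀ j, erasePos p K i j (chosenMarks n l r.1 i j) =
          K i j (chosenMarks n l r.1 i j) := by
        intro j
        refine if_neg ?_
        rintro rfl
        exact hx rfl
      simp only [markRows, this]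
    simp only [prepareStage, h]
    exact add_comm _ _

/-- For each family of keys the effect of the switch is the same with and without the secret key at
`p`. Averaging over the keys gives an equality, so no factor is lost to guessing the mark at `p`. -/
theorem advCPA_reduction {n ℓ : ℕ → ℕ} (hn : PolyBounded n) (hℓ : PolyBounded ℓ)
    (c : ∀ lam, Option ((Fin (n lam) → Fin (ℓ lam) → Bool → Bool) ×
      Fin (n lam) × Fin (ℓ lam) × Bool))
    (S : Fin (n lam) → Fin (ℓ lam) → Bool → Bool) (p : Fin (n lam) × Fin (ℓ lam) × Bool)
    (hc : c lam = some (S, p)) :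
    advCPA P (reduction P A hn hℓ c) lam =
      |(hybrid P A lam (setPos S p false) true).toReal -
        (hybrid P A lam (setPos S p true) true).toReal| := by
  have h := PMF.bind_apply_add_bind_apply (rawKeys P lam (n lam) (ℓ lam)) true fun K =>
    hybridWith_erasePos_add P A lam S p K true
  rw [← expCPA_reduction P A lam hn hℓ c S p hc, ← expCPA_reduction P A lam hn hℓ c S p hc] at h
  have h' := congrArg ENNReal.toReal h
  rw [ENNReal.toReal_add (PMF.apply_ne_top _ _) (PMF.apply_ne_top _ _),
    ENNReal.toReal_add (PMF.apply_ne_top _ _) (PMF.apply_ne_top _ _)] at h'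
  rw [advCPA]
  congr 1
  unfold hybrid
  linarith

/-- Switching positions one by one. -/
theorem abs_hybrid_sub_le (D : ℝ)
    (hD : ∀ (S : Fin n → Fin l → Bool → Bool) p,
      |(hybrid P A lam (setPos S p false) true).toReal -
        (hybrid P A lam (setPos S p true) true).toReal| ≤ D)
    (s : Finset (Fin n × Fin l × Bool)) :
    |(hybrid P A lam (n := n) (l := l) (fun _ _ _ => false) true).toReal -
      (hybrid P A lam (fun i j b => decide ((i, j, b) ∈ s)) true).toReal| ≤ s.card * D := by
  induction s using Finset.induction_on with
  | empty => simp
  | insert p s hp ih =>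
    have h1 := hD (fun i j b => decide ((i, j, b) ∈ s)) p
    -- As `p ∉ s`, setting the value at `p` to `false` leaves `s` as it is, and setting it to `true`
    -- inserts `p`.
    have e0 : setPos (fun i j b => decide ((i, j, b) ∈ s)) p false =
        fun i j b => decide ((i, j, b) ∈ s) := by
      funext i j b
      unfold setPos
      split_ifs with h
      · simp [h, hp]
      · rfl
    have e1 : setPos (fun i j b => decide ((i, j, b) ∈ s)) p true =
        fun i j b => decide ((i, j, b) ∈ insert p s) := by
      funext i j b
      unfold setPos
      split_ifs with h <;> simp [h]
    rw [e0, e1] at h1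
    rw [Finset.card_insert_of_notMem hp]
    push_cast
    have := abs_sub_le (hybrid P A lam (n := n) (l := l) (fun _ _ _ => false) true).toReal
      (hybrid P A lam (fun i j b => decide ((i, j, b) ∈ s)) true).toReal
      (hybrid P A lam (fun i j b => decide ((i, j, b) ∈ insert p s)) true).toReal
    linarith

end Reduction

/-! ### The main theorem -/

theorem mainTheorem6 (P : PKE) (ℓ : ℕ → ℕ) (hℓ : PolyBounded ℓ) (hP : P.INDCPA) :
    (wpkeOf P ℓ).ParallelMarkExtractable := by
  refine ⟨P.extractor, P.polyTime_extractor, fun n hn A => ?_⟩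
  -- There are finitely many configurations for each `lam`, so one has the largest gap. As advice it
  -- makes a single adversary dominate every step of the chain.
  have hmax : ∀ lam, ∃ c : Option ((Fin (n lam) → Fin (ℓ lam) → Bool → Bool) ×
      Fin (n lam) × Fin (ℓ lam) × Bool),
      ∀ (S : Fin (n lam) → Fin (ℓ lam) → Bool → Bool) (p : Fin (n lam) × Fin (ℓ lam) × Bool),
      ∃ S' p', c = some (S', p') ∧
      |(hybrid P A lam (setPos S p false) true).toReal -
        (hybrid P A lam (setPos S p true) true).toReal| ≤
      |(hybrid P A lam (setPos S' p' false) true).toReal -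
        (hybrid P A lam (setPos S' p' true) true).toReal| := by
    intro lam
    rcases isEmpty_or_nonempty ((Fin (n lam) → Fin (ℓ lam) → Bool → Bool) ×
      Fin (n lam) × Fin (ℓ lam) × Bool) with h | h
    -- If `n lam` or `ℓ lam` is zero there are no positions, hence no steps to bound, and the advice
    -- is a default.
    · exact ⟨none, fun S p => h.elim (S, p)⟩
    · obtain ⟨c, hc⟩ := Finite.exists_max fun c : (Fin (n lam) → Fin (ℓ lam) → Bool → Bool) ×
        Fin (n lam) × Fin (ℓ lam) × Bool =>
        |(hybrid P A lam (setPos c.1 c.2 false) true).toReal -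
          (hybrid P A lam (setPos c.1 c.2 true) true).toReal|
      exact ⟨some c, fun S p => ⟨c.1, c.2, rfl, hc (S, p)⟩⟩
  choose c hc using hmax
  obtain ⟨p, hp⟩ := id hn
  obtain ⟨q, hq⟩ := id hℓ
  -- The factor bounds the number `n * ℓ * 2` of positions. It is a polynomial so that the product
  -- with a negligible function stays negligible.
  refine ⟨fun lam => ((2 * p * q).map (Nat.castRingHom ℝ)).eval (lam : ℝ) *
    advCPA P (reduction P A hn hℓ c) lam, (hP _).polynomial_mul _, fun lam => ?_⟩
  have h := abs_hybrid_sub_le P A lam (advCPA P (reduction P A hn hℓ c) lam)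
    (fun S t => by
      obtain ⟨S', t', hct, hle⟩ := hc lam S t
      rwa [advCPA_reduction P A lam _ hℓ c S' t' hct]) Finset.univ
  have hcard : ((Finset.univ : Finset (Fin (n lam) × Fin (ℓ lam) × Bool)).card : ℝ) ≤
      ((2 * p * q).map (Nat.castRingHom ℝ)).eval (lam : ℝ) := by
    have e : ((2 * p * q).map (Nat.castRingHom ℝ)).eval (lam : ℝ) =
        ((2 * p.eval lam * q.eval lam : ℕ) : ℝ) := by
      simp
    rw [e]
    have h1 := Nat.mul_le_mul (hp lam) (hq lam)
    simp only [Finset.card_univ, Fintype.card_prod, Fintype.card_fin, Fintype.card_bool]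
    exact_mod_cast (by nlinarith : n lam * (ℓ lam * 2) ≤ 2 * p.eval lam * q.eval lam)
  have hadv : 0 ≤ advCPA P (reduction P A hn hℓ c) lam := abs_nonneg _
  have h2 := mul_le_mul_of_nonneg_right hcard hadv
  have h3 := (abs_le.mp h).2
  simp only [Finset.mem_univ, decide_true] at h3
  rw [advParOW, advParExt, expParOW_eq_hybrid, expParExt_eq_hybrid]
  linarith
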